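/- Theorem 3.2 (Upper Bound on Moment Estimation without Sufficient Smoothness). Let $d\in\mathbb N$, let $\Omega=[0,1]^d$, let $s\ge 0$ and $q\ge 1$ be integers and let $p$ be a real number with $p>2$, $q<p<2q$ and $s<\frac{d(2q-p)}{2pq}$. Let $W^{s,p}(\Omega)$ be the Sobolev space of all $f\in L^p(\Omega)$ whose weak derivatives $D^\alpha f$, $|\alpha|\le s$, are in $L^p(\Omega)$, with norm $\|f\|_{W^{s,p}}=\big(\sum_{|\alpha|\le s}\|D^\alpha f\|_{L^p(\Omega)}^p\big)^{1/p}$. Let $x_1,\dots,x_n$ be independent and uniformly distributed on $\Omega$, let $y_i=f(x_i)$ be the observations of $f\in W^{s,p}(\Omega)$, and let $I_f^q=\int_\Omega f(x)^q\,dx$. For $M>0$ put $$\hat H_M^q(\{x_i\},\{y_i\})=\frac1n\sum_{i=1}^n \max\{\min\{y_i,M\},-M\}^q .$$ (a) For all $L,a,b>0$ there is a constant $C>0$, depending only on $d,s,p,q,L,a,b$, such that for every $n\ge 1$, every $M$ with $a\,n^{\frac1p-\frac sd}\le M\le b\,n^{\frac1p-\frac sd}$ and every $f\in W^{s,p}(\Omega)$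 with $\|f\|_{W^{s,p}}\le L$, $$\mathbb E\big|\hat H_M^q(\{x_i\},\{y_i\})-I_f^q\big|\le C\,n^{-q(\frac sd-\frac1p)-1}.$$ (b) This rate is minimax optimal: for every $L>0$ there is a constant $c>0$, depending only on $d,s,p,q,L$, such that for every $n\ge1$ $$\inf_{\hat H}\ \sup_{\|f\|_{W^{s,p}}\le L}\ \mathbb E\big|\hat H(\{x_i\},\{y_i\})-I_f^q\big|\ge c\,n^{-q(\frac sd-\frac1p)-1},$$ where the infimum is over all measurable $\hat H:\Omega^n\times\mathbb R^n\to\mathbb R$. -/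

import Mathlib

open MeasureTheory
open scoped ENNReal ContDiff

noncomputable section

namespace MomentEstimation

/-- The closed unit cube `[0,1]^d`. -/
def cube (d : ℕ) : Set (Fin d → ℝ) := Set.Icc 0 1

/-- The open unit cube `(0,1)^d`, the interior of the closed one. -/
def openCube (d : ℕ) : Set (Fin d → ℝ) := Set.pi Set.univ fun _ => Set.Ioo (0 : ℝ) 1

/-- Lebesgue measure on the unit cube, that is, the uniform distribution on it. -/
def unif (d : ℕ) : Measure (Fin d → ℝ) := (volume : Measure (Fin d → ℝ)).restrict (cube d)

instance instIsProbabilityMeasureUnif (d : ℕ) : IsProbabilityMeasure (unif d) :=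
  ⟨by simp [unif, cube, Real.volume_Icc_pi]⟩

/-- The classical `i`-th partial derivative. -/
def partialDeriv {d : ℕ} (i : Fin d) (φ : (Fin d → ℝ) → ℝ) : (Fin d → ℝ) → ℝ :=
  fun x => fderiv ℝ φ x (Pi.single i 1)

/-- The classical derivative `D^α φ = ∂₁^{α₁} ⋯ ∂_d^{α_d} φ` for a multi-index `α`. -/
def multiDeriv {d : ℕ} (α : Fin d → ℕ) (φ : (Fin d → ℝ) → ℝ) : (Fin d → ℝ) → ℝ :=
  (List.finRange d).foldr (fun i ψ => (partialDeriv i)^[α i] ψ) φ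

/-- Test functions: smooth functions with compact support inside the open unit cube. -/
def IsTestFunction {d : ℕ} (φ : (Fin d → ℝ) → ℝ) : Prop :=
  ContDiff ℝ ∞ φ ∧ HasCompactSupport φ ∧ tsupport φ ⊆ openCube d

/-- `g` is the weak derivative `D^α f` on the unit cube. (Used for `f, g ∈ L^p` of the cube, so
that both integrals converge; `g` is then determined by `f` almost everywhere on the cube.) -/
def IsWeakDeriv {d : ℕ} (α : Fin d → ℕ) (f g : (Fin d → ℝ) → ℝ) : Prop :=
  ∀ φ : (Fin d → ℝ) → ℝ, IsTestFunction φ →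
    ∫ x, f x * multiDeriv α φ x ∂(unif d) = (-1) ^ (∑ i, α i) * ∫ x, g x * φ x ∂(unif d)

/-- `f ∈ W^{s,p}([0,1]^d)`: `f` and its weak derivatives of order at most `s` are in `L^p`.
Only the values of `f` on the unit cube matter. -/
def MemSobolev (d s : ℕ) (p : ℝ) (f : (Fin d → ℝ) → ℝ) : Prop :=
  MemLp f (ENNReal.ofReal p) (unif d) ∧
    ∀ α : Fin d → ℕ, ∑ i, α i ≤ s →
      ∃ g : (Fin d → ℝ) → ℝ, MemLp g (ENNReal.ofReal p) (unif d) ∧ IsWeakDeriv α f g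

/-- `‖D^α f‖_{L^p}`. As weak derivatives are unique up to null sets, the infimum runs over a
single almost everywhere class; it is `∞` if there is no weak derivative in `L^p`. -/
def derivNorm (d : ℕ) (p : ℝ) (α : Fin d → ℕ) (f : (Fin d → ℝ) → ℝ) : ℝ≥0∞ :=
  ⨅ (g : (Fin d → ℝ) → ℝ) (_ : MemLp g (ENNReal.ofReal p) (unif d)) (_ : IsWeakDeriv α f g),
    eLpNorm g (ENNReal.ofReal p) (unif d)

/-- The multi-indices of order at most `s` in dimension `d`. -/
def multiIndices (d s : ℕ) : Finset (Fin d → ℕ) :=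
  (Finset.Iic fun _ => s).filter fun α => ∑ i, α i ≤ s

/-- The Sobolev norm `(∑_{|α| ≤ s} ‖D^α f‖_{L^p}^p)^{1/p}`, for `1 ≤ p < ∞`. -/
def sobolevNorm (d s : ℕ) (p : ℝ) (f : (Fin d → ℝ) → ℝ) : ℝ≥0∞ :=
  (∑ α ∈ multiIndices d s, derivNorm d p α f ^ p) ^ (1 / p)

/-- The ball of radius `L` around `0` in `W^{s,p}([0,1]^d)`. -/
def sobolevBall (d s : ℕ) (p L : ℝ) : Set ((Fin d → ℝ) → ℝ) :=
  {f | MemSobolev d s p f ∧ sobolevNorm d s p f ≤ ENNReal.ofReal L}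

/-- The `q`-th moment `∫ f^q` over the unit cube. -/
def moment (d q : ℕ) (f : (Fin d → ℝ) → ℝ) : ℝ := ∫ x, f x ^ q ∂(unif d)

/-- An estimator: a real function of `n` quadrature points and `n` observations (measurability is
required where one quantifies over all estimators). -/
abbrev Estimator (d n : ℕ) := (Fin n → Fin d → ℝ) → (Fin n → ℝ) → ℝ

/-- The expected absolute error of the estimator `H` of the `q`-th moment of `f`, for `n` points
`x i` drawn independently from the uniform distribution, and observations `y i = f (x i)`. -/
def expectedError (d n q : ℕ) (H : Estimator d n) (f : (Fin d → ℝ) → ℝ) : ℝ≥0∞ :=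
  ∫⁻ x : Fin n → Fin d → ℝ, ENNReal.ofReal |H x (fun i => f (x i)) - moment d q f|
    ∂(Measure.pi fun _ : Fin n => unif d)

/-- The truncated Monte Carlo estimator `(1/n) ∑ max{min{y_i, M}, -M}^q`. -/
def truncatedMC (d n q : ℕ) (M : ℝ) : Estimator d n :=
  fun _ y => (1 / (n : ℝ)) * ∑ i, max (min (y i) M) (-M) ^ q

/-- The minimax risk over the Sobolev ball of radius `L`: the infimum over all measurable
estimators of the largest expected absolute error over the ball. -/
def minimaxRisk (d n q s : ℕ) (p L : ℝ) : ℝ≥0∞ :=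
  ⨅ (H : Estimator d n) (_ : Measurable fun z : (Fin n → Fin d → ℝ) × (Fin n → ℝ) => H z.1 z.2),
    ⨆ f ∈ sobolevBall d s p L, expectedError d n q H f

end MomentEstimation

end

noncomputable section

namespace MomentEstimation

variable {d : ℕ}

/-! Upper bound. Put 1/r = 1/p - s/d; the hypotheses amount to q < p ≤ r < 2q. All that is needed of
the Sobolev ball is its weak L^r bound: |{|f| > t}| ≤ K t^{-r} (`exists_weak_type`). By the
layer-cake formula the bias of the truncated mean is at most a constant times the integral of |f|^q
over {|f| > M}, of order M^{q-r} because q < r. Its variance is at most 1/n times the integral of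
min(|f|, M)^{2q}, of order M^{2q-r}/n because r < 2q. For M of order n^{1/r}, bias and standard
deviation both have order n^{q/r-1}.

The weak-type inequality is proved directly on the cube, without extension operators. Fix a test
function ψ and average f against the law of (1-t)x + tY, where Y has density ψ; by convexity this
law lives in the cube. Its density obeys a continuity equation in t (`sum_partialDeriv_kern_tilt`),
so the t-derivative of the average is a sum of such averages of first weak derivatives. Iterating
down from scale h, with Jensen's bound t^{-d/p} for averages of L^p functions, and letting the scale
tend to 0, gives almost everywhere |f(x)| ≤ C Λ h^{s-d/p} + C h^{s-1} ∫_0^h (average of F at scale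
t) dt, where F dominates all derivatives. The integral has L^p norm O(h Λ), so by Chebyshev |f|
exceeds twice the first term only on a set of measure O(h^d). Choosing h according to the level t
gives the exponent r.

Lower bound. A smooth bump of width n^{-1/d} and height of order n^{1/p-s/d} lies in the ball, and
its q-th moment has the order of the rate. Its support has measure at most 1/(2n), so with
probability at least 1/2 no sample point hits it, and the data are those of f = 0. No estimator can
then be close to both moments. -/

/-! ### Iterated classical derivatives and multi-indices -/

lemma contDiff_partialDeriv (i : Fin d) {φ : (Fin d → ℝ) → ℝ} (h : ContDiff ℝ ∞ φ) :
    ContDiff ℝ ∞ (partialDeriv i φ) := by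
  unfold partialDeriv
  exact (h.fderiv_right (m := ∞) (by simp)).clm_apply contDiff_const

lemma partialDeriv_comm (i j : Fin d) {φ : (Fin d → ℝ) → ℝ} (h : ContDiff ℝ ∞ φ) :
    partialDeriv i (partialDeriv j φ) = partialDeriv j (partialDeriv i φ) := by
  have key : ∀ (v w x : Fin d → ℝ), fderiv ℝ (fun y => fderiv ℝ φ y v) x w
      = fderiv ℝ (fderiv ℝ φ) x w v := by
    intro v w x
    have h1 : DifferentiableAt ℝ (fderiv ℝ φ) x :=
      ((h.fderiv_right (m := ∞) (by simp)).differentiable (by simp)).differentiableAt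
    rw [fderiv_clm_apply h1 (differentiableAt_const _)]
    simp
  ext x
  change fderiv ℝ (fun y => fderiv ℝ φ y _) x _ = fderiv ℝ (fun y => fderiv ℝ φ y _) x _
  rw [key, key]
  exact (h.contDiffAt.isSymmSndFDerivAt
    (by simpa using WithTop.coe_le_coe.2 (le_top : (2 : ℕ∞) ≤ ⊤))).eq _ _

lemma contDiff_iterate_partialDeriv (i : Fin d) (k : ℕ) {φ : (Fin d → ℝ) → ℝ}
    (h : ContDiff ℝ ∞ φ) : ContDiff ℝ ∞ ((partialDeriv i)^[k] φ) := by
  induction k with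
  | zero => exact h
  | succ k ih => rw [Function.iterate_succ_apply']; exact contDiff_partialDeriv i ih

lemma partialDeriv_iterate_comm (i j : Fin d) (k : ℕ) {φ : (Fin d → ℝ) → ℝ}
    (h : ContDiff ℝ ∞ φ) :
    partialDeriv i ((partialDeriv j)^[k] φ) = (partialDeriv j)^[k] (partialDeriv i φ) := by
  induction k with
  | zero => rfl
  | succ k ih =>
    rw [Function.iterate_succ_apply', Function.iterate_succ_apply', ← ih,
      partialDeriv_comm i j (contDiff_iterate_partialDeriv j k h)]

/-- The derivatives `∂ᵢ^{αᵢ}`, `i` running through a list, applied one after the other. -/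
def listDeriv (l : List (Fin d)) (α : Fin d → ℕ) (φ : (Fin d → ℝ) → ℝ) : (Fin d → ℝ) → ℝ :=
  l.foldr (fun i ψ => (partialDeriv i)^[α i] ψ) φ

lemma contDiff_listDeriv (l : List (Fin d)) (α : Fin d → ℕ) {φ : (Fin d → ℝ) → ℝ}
    (h : ContDiff ℝ ∞ φ) : ContDiff ℝ ∞ (listDeriv l α φ) := by
  induction l with
  | nil => exact h
  | cons j l ih => exact contDiff_iterate_partialDeriv j _ ih

lemma partialDeriv_listDeriv (i : Fin d) (l : List (Fin d)) (α : Fin d → ℕ)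
    {φ : (Fin d → ℝ) → ℝ} (h : ContDiff ℝ ∞ φ) :
    partialDeriv i (listDeriv l α φ) = listDeriv l α (partialDeriv i φ) := by
  induction l with
  | nil => rfl
  | cons j l ih =>
    have : ∀ φ, listDeriv (j :: l) α φ = (partialDeriv j)^[α j] (listDeriv l α φ) := fun _ => rfl
    rw [this, this, partialDeriv_iterate_comm i j _ (contDiff_listDeriv l α h), ih]

/-- The order of differentiation is fixed by the list, so an extra ∂ᵢ has to be commuted out to the
front; `Nodup` ensures that it is picked up only once. -/
lemma listDeriv_add_single (i : Fin d) (l : List (Fin d)) (hl : l.Nodup) (α : Fin d → ℕ)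
    {φ : (Fin d → ℝ) → ℝ} (h : ContDiff ℝ ∞ φ) :
    listDeriv l (α + Pi.single i 1) φ =
      if i ∈ l then partialDeriv i (listDeriv l α φ) else listDeriv l α φ := by
  induction l with
  | nil => simp [listDeriv]
  | cons j l ih =>
    have e : ∀ α φ, listDeriv (j :: l) α φ = (partialDeriv j)^[α j] (listDeriv l α φ) :=
      fun _ _ => rfl
    have hnd := List.nodup_cons.1 hl
    rw [e, e, ih hnd.2]
    by_cases hij : i = j
    · subst hij
      simp [hnd.1, Function.iterate_succ_apply']
    · have hji : j ≠ i := fun h => hij h.symm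
      by_cases hil : i ∈ l
      · simp [hij, hji, hil, partialDeriv_iterate_comm i j _ (contDiff_listDeriv l α h)]
      · simp [hij, hji, hil]

lemma contDiff_multiDeriv (α : Fin d → ℕ) {φ : (Fin d → ℝ) → ℝ} (h : ContDiff ℝ ∞ φ) :
    ContDiff ℝ ∞ (multiDeriv α φ) :=
  contDiff_listDeriv (List.finRange d) α h

lemma partialDeriv_multiDeriv (i : Fin d) (α : Fin d → ℕ) {φ : (Fin d → ℝ) → ℝ}
    (h : ContDiff ℝ ∞ φ) :
    partialDeriv i (multiDeriv α φ) = multiDeriv α (partialDeriv i φ) :=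
  partialDeriv_listDeriv i (List.finRange d) α h

lemma multiDeriv_add_single (i : Fin d) (α : Fin d → ℕ) {φ : (Fin d → ℝ) → ℝ}
    (h : ContDiff ℝ ∞ φ) :
    multiDeriv (α + Pi.single i 1) φ = partialDeriv i (multiDeriv α φ) := by
  have := listDeriv_add_single i (List.finRange d) (List.nodup_finRange d) α h
  rw [if_pos (List.mem_finRange i)] at this
  exact this

lemma multiDeriv_zero (φ : (Fin d → ℝ) → ℝ) : multiDeriv 0 φ = φ := by
  unfold multiDeriv
  induction List.finRange d with
  | nil => rfl
  | cons j l ih => simp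

/-- Induction over multi-indices, raising one entry at a time. -/
lemma multiIndex_induction {P : (Fin d → ℕ) → Prop} (h0 : P 0)
    (hs : ∀ α i, P α → P (α + Pi.single i 1)) (α : Fin d → ℕ) : P α := by
  induction hk : ∑ i, α i generalizing α with
  | zero =>
    have : α = 0 := by
      ext i
      exact (Finset.sum_eq_zero_iff.1 hk) i (Finset.mem_univ i)
    rwa [this]
  | succ k ih =>
    obtain ⟨i, hi⟩ : ∃ i, α i ≠ 0 := by
      by_contra! hcon
      simp [hcon] at hk
    have e : α = (α - Pi.single i 1) + Pi.single i 1 := by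
      ext j
      by_cases hj : j = i
      · subst hj; simp; omega
      · simp [hj]
    rw [e]
    refine hs _ _ (ih _ ?_)
    have : ∑ j, α j = ∑ j, (α - Pi.single i 1 : Fin d → ℕ) j + 1 := by
      conv_lhs => rw [e]
      simp [Finset.sum_add_distrib]
    omega

lemma sum_add_single (α : Fin d → ℕ) (i : Fin d) :
    ∑ j, (α + Pi.single i 1 : Fin d → ℕ) j = ∑ j, α j + 1 := by
  simp [Finset.sum_add_distrib]

/-! ### Test functions and weak derivatives on the cube -/

lemma tsupport_partialDeriv_subset (i : Fin d) (φ : (Fin d → ℝ) → ℝ) :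
    tsupport (partialDeriv i φ) ⊆ tsupport φ := by
  refine closure_minimal (fun x hx => ?_) (isClosed_tsupport φ)
  by_contra hcon
  have := fderiv_of_notMem_tsupport (𝕜 := ℝ) hcon
  simp [partialDeriv, this] at hx

lemma IsTestFunction.mk_of_subset {φ ψ : (Fin d → ℝ) → ℝ} (h : IsTestFunction φ)
    (hψ : ContDiff ℝ ∞ ψ) (hs : tsupport ψ ⊆ tsupport φ) : IsTestFunction ψ :=
  ⟨hψ, IsCompact.of_isClosed_subset h.2.1 (isClosed_tsupport ψ) hs, hs.trans h.2.2⟩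

lemma IsTestFunction.partialDeriv {φ : (Fin d → ℝ) → ℝ} (h : IsTestFunction φ) (i : Fin d) :
    IsTestFunction (partialDeriv i φ) :=
  h.mk_of_subset (contDiff_partialDeriv i h.1) (tsupport_partialDeriv_subset i φ)

lemma tsupport_multiDeriv_subset (α : Fin d → ℕ) {φ : (Fin d → ℝ) → ℝ} (h : ContDiff ℝ ∞ φ) :
    tsupport (multiDeriv α φ) ⊆ tsupport φ := by
  induction α using multiIndex_induction with
  | h0 => rw [multiDeriv_zero]
  | hs α i ih =>
    rw [multiDeriv_add_single i α h]
    exact (tsupport_partialDeriv_subset i _).trans ih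

lemma IsTestFunction.multiDeriv {φ : (Fin d → ℝ) → ℝ} (h : IsTestFunction φ) (α : Fin d → ℕ) :
    IsTestFunction (multiDeriv α φ) :=
  h.mk_of_subset (contDiff_multiDeriv α h.1) (tsupport_multiDeriv_subset α h.1)

lemma openCube_subset_cube (d : ℕ) : openCube d ⊆ cube d := by
  intro x hx
  simp only [openCube, Set.mem_pi, Set.mem_univ, true_implies, Set.mem_Ioo] at hx
  exact ⟨fun i => (hx i).1.le, fun i => (hx i).2.le⟩

lemma isOpen_openCube (d : ℕ) : IsOpen (openCube d) :=
  isOpen_set_pi Set.finite_univ fun _ _ => isOpen_Ioo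

lemma measurableSet_cube (d : ℕ) : MeasurableSet (cube d) := measurableSet_Icc

lemma unif_eq_restrict_openCube (d : ℕ) : unif d = volume.restrict (openCube d) := by
  unfold unif cube openCube
  exact (Measure.restrict_congr_set (Measure.univ_pi_Ioo_ae_eq_Icc
    (μ := fun _ : Fin d => (volume : Measure ℝ)) (f := 0) (g := 1))).symm

lemma IsTestFunction.eq_zero {φ : (Fin d → ℝ) → ℝ} (h : IsTestFunction φ) {x : Fin d → ℝ}
    (hx : x ∉ cube d) : φ x = 0 :=
  image_eq_zero_of_notMem_tsupport fun hm => hx (openCube_subset_cube d (h.2.2 hm))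

lemma integral_unif_eq_integral {F : (Fin d → ℝ) → ℝ} (h : ∀ x ∉ cube d, F x = 0) :
    ∫ x, F x ∂(unif d) = ∫ x, F x :=
  setIntegral_eq_integral_of_forall_compl_eq_zero h

/-- Classical derivatives of test functions are weak derivatives. -/
lemma isWeakDeriv_multiDeriv {f : (Fin d → ℝ) → ℝ} (hf : IsTestFunction f) (α : Fin d → ℕ) :
    IsWeakDeriv α f (multiDeriv α f) := by
  induction α using multiIndex_induction with
  | h0 => intro φ _; simp [multiDeriv_zero]
  | hs α i ih =>
    intro φ hφ
    have hDf := hf.multiDeriv α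
    rw [multiDeriv_add_single i α hφ.1, partialDeriv_multiDeriv i α hφ.1, ih _ (hφ.partialDeriv i),
      sum_add_single, pow_succ, mul_assoc]
    congr 1
    rw [integral_unif_eq_integral fun x hx => by simp [hDf.eq_zero hx],
      integral_unif_eq_integral fun x hx => by simp [hφ.eq_zero hx], neg_one_mul,
      multiDeriv_add_single i α hf.1]
    have cf := hDf.1.continuous
    have cφ := hφ.1.continuous
    have cf' := (hDf.partialDeriv i).1.continuous
    have cφ' := (hφ.partialDeriv i).1.continuous
    refine integral_mul_fderiv_eq_neg_fderiv_mul_of_integrable (μ := volume)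
      (f := MomentEstimation.multiDeriv α f) (g := φ) (v := Pi.single i 1) ?_ ?_ ?_
      (fun x _ => (hDf.1.differentiable (by simp)) x)
      (fun x _ => (hφ.1.differentiable (by simp)) x)
    · exact (cf'.mul cφ).integrable_of_hasCompactSupport (HasCompactSupport.mul_left hφ.2.1)
    · exact (cf.mul cφ').integrable_of_hasCompactSupport (HasCompactSupport.mul_right hDf.2.1)
    · exact (cf.mul cφ).integrable_of_hasCompactSupport (HasCompactSupport.mul_right hDf.2.1)

/-- Successive weak derivatives of f are weak partial derivatives of one another: test g with ∂ᵢφ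
and g' with φ, and compare. -/
lemma integral_weakDeriv_partialDeriv {f g g' : (Fin d → ℝ) → ℝ} {α : Fin d → ℕ} {i : Fin d}
    (hg : IsWeakDeriv α f g) (hg' : IsWeakDeriv (α + Pi.single i 1) f g')
    {φ : (Fin d → ℝ) → ℝ} (hφ : IsTestFunction φ) :
    ∫ x, g x * partialDeriv i φ x ∂(unif d) = - ∫ x, g' x * φ x ∂(unif d) := by
  have h1 := hg _ (hφ.partialDeriv i)
  have h2 := hg' _ hφ
  rw [multiDeriv_add_single i α hφ.1, partialDeriv_multiDeriv i α hφ.1, h1, sum_add_single,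
    pow_succ, mul_assoc] at h2
  simpa using mul_left_cancel₀ (pow_ne_zero _ (by norm_num)) h2

lemma multiDeriv_comp_affine (α : Fin d → ℕ) {K : (Fin d → ℝ) → ℝ} (hK : ContDiff ℝ ∞ K)
    (c t : ℝ) (b : Fin d → ℝ) :
    multiDeriv α (fun x => c * K (b + t • x)) =
      fun x => c * t ^ (∑ i, α i) * multiDeriv α K (b + t • x) := by
  have hA : ContDiff ℝ ∞ fun x : Fin d → ℝ => b + t • x := by fun_prop
  induction α using multiIndex_induction with
  | h0 => simp [multiDeriv_zero]
  | hs α i ih =>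
    have hc : ContDiff ℝ ∞ fun x => c * K (b + t • x) := contDiff_const.mul (hK.comp hA)
    rw [multiDeriv_add_single i α hc, ih,
      multiDeriv_add_single i α hK, sum_add_single]
    ext x
    have hd := ((contDiff_multiDeriv α hK).differentiable (by simp)) (b + t • x)
    have h1 : HasFDerivAt (fun x : Fin d → ℝ => b + t • x)
        (t • ContinuousLinearMap.id ℝ (Fin d → ℝ)) x :=
      ((hasFDerivAt_id x).const_smul t).const_add b
    have h2 := (hd.hasFDerivAt.comp x h1).const_mul (c * t ^ (∑ i, α i))
    have h3 := h2.fderiv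
    simp only [partialDeriv]
    simp only [Function.comp_def] at h3
    rw [h3]
    simp
    ring

/-! ### Averages against laws contracted towards a point -/

/-- If `Y` has density `ψ`, then `(1 - t) x + t Y` has density `kern ψ x t`. -/
def kern (ψ : (Fin d → ℝ) → ℝ) (x : Fin d → ℝ) (t : ℝ) (z : Fin d → ℝ) : ℝ :=
  t⁻¹ ^ d * ψ (x + t⁻¹ • (z - x))

/-- The derivative of `kern ψ x t z` with respect to `t`. -/
def kernDeriv (ψ : (Fin d → ℝ) → ℝ) (x : Fin d → ℝ) (t : ℝ) (z : Fin d → ℝ) : ℝ :=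
  -(d * t⁻¹ ^ (d + 1) * ψ (x + t⁻¹ • (z - x)) +
    t⁻¹ ^ (d + 2) * fderiv ℝ ψ (x + t⁻¹ • (z - x)) (z - x))

/-- The product of `ψ` with the `i`-th coordinate of `y - x`. -/
def tilt (x : Fin d → ℝ) (i : Fin d) (ψ : (Fin d → ℝ) → ℝ) (y : Fin d → ℝ) : ℝ :=
  (y i - x i) * ψ y

/-- The average of `f` against `kern ψ x t`. -/
def avg (f ψ : (Fin d → ℝ) → ℝ) (x : Fin d → ℝ) (t : ℝ) : ℝ :=
  ∫ z, f z * kern ψ x t z ∂(unif d)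

lemma convexComb_mem_openCube {x y : Fin d → ℝ} (hx : x ∈ cube d) (hy : y ∈ openCube d) {t : ℝ}
    (h0 : 0 < t) (h1 : t ≤ 1) : x + t • (y - x) ∈ openCube d := by
  simp only [openCube, Set.mem_pi, Set.mem_univ, true_implies, Set.mem_Ioo] at hy ⊢
  intro i
  have a := hx.1 i
  have b := hx.2 i
  simp only [Pi.zero_apply, Pi.one_apply] at a b
  simp only [Pi.add_apply, Pi.smul_apply, Pi.sub_apply, smul_eq_mul]
  constructor <;> nlinarith [(hy i).1, (hy i).2]

lemma convexComb_mem_cube {x y : Fin d → ℝ} (hx : x ∈ cube d) (hy : y ∈ cube d) {t : ℝ}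
    (h0 : 0 ≤ t) (h1 : t ≤ 1) : x + t • (y - x) ∈ cube d := by
  refine ⟨fun i => ?_, fun i => ?_⟩ <;>
  · have a := hx.1 i
    have b := hx.2 i
    have a' := hy.1 i
    have b' := hy.2 i
    simp only [Pi.zero_apply, Pi.one_apply] at a b a' b'
    simp only [Pi.add_apply, Pi.smul_apply, Pi.sub_apply, smul_eq_mul, Pi.zero_apply, Pi.one_apply]
    nlinarith

lemma IsTestFunction.kern {ψ : (Fin d → ℝ) → ℝ} (h : IsTestFunction ψ) {x : Fin d → ℝ}
    (hx : x ∈ cube d) {t : ℝ} (h0 : 0 < t) (h1 : t ≤ 1) : IsTestFunction (kern ψ x t) := by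
  have key : tsupport (MomentEstimation.kern ψ x t) ⊆
      (fun y => x + t • (y - x)) '' tsupport ψ := by
    have hc : IsClosed ((fun y => x + t • (y - x)) '' tsupport ψ) :=
      (IsCompact.image h.2.1 (by fun_prop)).isClosed
    refine closure_minimal (fun z hz => ?_) hc
    refine ⟨x + t⁻¹ • (z - x), subset_closure ?_, ?_⟩
    · intro h0
      apply hz
      simp [MomentEstimation.kern, h0]
    · simp [smul_smul, h0.ne']
  refine ⟨?_, ?_, ?_⟩
  · exact contDiff_const.mul (h.1.comp (by fun_prop))
  · exact IsCompact.of_isClosed_subset (IsCompact.image h.2.1 (by fun_prop)) (isClosed_tsupport _)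
      key
  · rintro z hz
    obtain ⟨y, hy, rfl⟩ := key hz
    exact convexComb_mem_openCube hx (h.2.2 hy) h0 h1

lemma IsTestFunction.tilt {ψ : (Fin d → ℝ) → ℝ} (h : IsTestFunction ψ) (x : Fin d → ℝ)
    (i : Fin d) : IsTestFunction (tilt x i ψ) := by
  refine h.mk_of_subset ?_ ?_
  · have : ContDiff ℝ ∞ fun y : Fin d → ℝ => y i - x i := by fun_prop
    exact this.mul h.1
  · exact closure_mono (Function.support_mul_subset_right _ _)

/-- Coordinates of points of the cube differ by at most 1, and ψ vanishes off the cube. Hence one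
bound B serves through all iterations, each of which tilts ψ once more. -/
lemma abs_tilt_le {ψ : (Fin d → ℝ) → ℝ} (h : IsTestFunction ψ) {x : Fin d → ℝ} (hx : x ∈ cube d)
    (i : Fin d) {B : ℝ} (hB : ∀ y, |ψ y| ≤ B) (y : Fin d → ℝ) : |tilt x i ψ y| ≤ B := by
  by_cases hy : y ∈ cube d
  · have a := hx.1 i
    have b := hx.2 i
    have a' := hy.1 i
    have b' := hy.2 i
    simp only [Pi.zero_apply, Pi.one_apply] at a b a' b'
    have : |y i - x i| ≤ 1 := abs_le.2 ⟨by linarith, by linarith⟩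
    calc |tilt x i ψ y| = |y i - x i| * |ψ y| := abs_mul _ _
      _ ≤ 1 * |ψ y| := by gcongr
      _ ≤ B := by rw [one_mul]; exact hB y
  · rw [(h.tilt x i).eq_zero hy, abs_zero]
    exact (abs_nonneg _).trans (hB y)

lemma hasDerivAt_kern {ψ : (Fin d → ℝ) → ℝ} (h : Differentiable ℝ ψ) (x z : Fin d → ℝ) {t : ℝ}
    (ht : t ≠ 0) : HasDerivAt (fun t => kern ψ x t z) (kernDeriv ψ x t z) t := by
  have h1 : HasDerivAt (fun t : ℝ => t⁻¹) (-(t ^ 2)⁻¹) t := hasDerivAt_inv ht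
  have h2 : HasDerivAt (fun t : ℝ => x + t⁻¹ • (z - x)) (-(t ^ 2)⁻¹ • (z - x)) t :=
    (h1.smul_const (z - x)).const_add x
  have h3 := (h (x + t⁻¹ • (z - x))).hasFDerivAt.comp_hasDerivAt t h2
  have h4 := (h1.pow d).mul h3
  refine h4.congr_deriv ?_
  simp only [kernDeriv, Function.comp, map_smul, smul_eq_mul]
  have e : (t ^ 2)⁻¹ = t⁻¹ ^ 2 := (inv_pow t 2).symm
  rw [e]
  rw [Pi.pow_apply]
  -- The derivative of the d-th power carries the truncated exponent d - 1.
  rcases d with _ | d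
  · simp
  · simp only [Nat.add_sub_cancel]; push_cast; ring

/-- The continuity equation: the mass at (1-t)x + tY moves with velocity Y - x, and the i-th
component of the flux is the kernel of the tilted density. This turns a t-derivative into a
divergence, which can be integrated by parts onto f. -/
lemma sum_partialDeriv_kern_tilt {ψ : (Fin d → ℝ) → ℝ} (h : Differentiable ℝ ψ)
    (x z : Fin d → ℝ) (t : ℝ) :
    ∑ i, partialDeriv i (kern (tilt x i ψ) x t) z = -kernDeriv ψ x t z := by
  have key : ∀ i, partialDeriv i (kern (tilt x i ψ) x t) z =
      t⁻¹ ^ (d + 1) * ψ (x + t⁻¹ • (z - x)) + t⁻¹ ^ (d + 2) *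
        ((z i - x i) * fderiv ℝ ψ (x + t⁻¹ • (z - x)) (Pi.single i 1)) := by
    intro i
    have h1 : HasFDerivAt (fun z : Fin d → ℝ => x + t⁻¹ • (z - x))
        (t⁻¹ • ContinuousLinearMap.id ℝ (Fin d → ℝ)) z :=
      (((hasFDerivAt_id z).sub_const x).const_smul t⁻¹).const_add x
    have h2 := (h (x + t⁻¹ • (z - x))).hasFDerivAt.comp z h1
    have h3 : HasFDerivAt (fun z : Fin d → ℝ => t⁻¹ * (z i - x i))
        (t⁻¹ • ContinuousLinearMap.proj (R := ℝ) (φ := fun _ : Fin d => ℝ) i) z :=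
      ((ContinuousLinearMap.proj (R := ℝ) (φ := fun _ : Fin d => ℝ) i).hasFDerivAt.sub_const
        (x i)).const_mul t⁻¹
    have h4 := (h3.mul h2).const_mul (t⁻¹ ^ d)
    have e : kern (tilt x i ψ) x t = fun z => t⁻¹ ^ d * ((t⁻¹ * (z i - x i)) *
        (ψ ∘ fun z : Fin d → ℝ => x + t⁻¹ • (z - x)) z) := by
      ext z
      simp [kern, tilt]
    rw [partialDeriv, e]
    erw [h4.fderiv]
    simp
    ring
  rw [Finset.sum_congr rfl fun i _ => key i, Finset.sum_add_distrib, ← Finset.mul_sum]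
  have hz : fderiv ℝ ψ (x + t⁻¹ • (z - x)) (z - x) =
      ∑ i, (z i - x i) * fderiv ℝ ψ (x + t⁻¹ • (z - x)) (Pi.single i 1) := by
    generalize fderiv ℝ ψ (x + t⁻¹ • (z - x)) = A
    conv_lhs => rw [pi_eq_sum_univ' (z - x)]
    rw [map_sum]
    refine Finset.sum_congr rfl fun i _ => ?_
    rw [map_smul]
    simp
  rw [← Finset.mul_sum, ← hz, kernDeriv]
  simp
  ring

lemma norm_sub_le_one_of_mem_cube {x z : Fin d → ℝ} (hx : x ∈ cube d) (hz : z ∈ cube d) :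
    ‖z - x‖ ≤ 1 := by
  refine (pi_norm_le_iff_of_nonneg zero_le_one).2 fun i => ?_
  have a := hx.1 i
  have b := hx.2 i
  have a' := hz.1 i
  have b' := hz.2 i
  simp only [Pi.zero_apply, Pi.one_apply] at a b a' b'
  exact abs_le.2 ⟨by simp; linarith, by simp; linarith⟩

lemma ae_mem_cube (d : ℕ) : ∀ᵐ x ∂(unif d), x ∈ cube d :=
  ae_restrict_mem (measurableSet_cube d)

lemma IsTestFunction.exists_bound {ψ : (Fin d → ℝ) → ℝ} (h : IsTestFunction ψ) :
    ∃ B, ∀ y, |ψ y| ≤ B :=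
  HasCompactSupport.exists_bound_of_continuous h.2.1 h.1.continuous

lemma hasDerivAt_avg {ψ : (Fin d → ℝ) → ℝ} (h : IsTestFunction ψ) {f : (Fin d → ℝ) → ℝ}
    (hf : Integrable f (unif d)) {x : Fin d → ℝ} (hx : x ∈ cube d) {t : ℝ} (ht : 0 < t) :
    Integrable (fun z => f z * kernDeriv ψ x t z) (unif d) ∧
    HasDerivAt (avg f ψ x) (∫ z, f z * kernDeriv ψ x t z ∂(unif d)) t := by
  obtain ⟨B, hB⟩ := h.exists_bound
  obtain ⟨B', hB'⟩ := (h.2.1.fderiv ℝ).exists_bound_of_continuous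
    (h.1.continuous_fderiv (by simp))
  have hd : Differentiable ℝ ψ := h.1.differentiable (by simp)
  have hB0 : 0 ≤ B := (abs_nonneg _).trans (hB 0)
  have hB0' : 0 ≤ B' := (norm_nonneg _).trans (hB' 0)
  have cψ := h.1.continuous
  have cψ' := h.1.continuous_fderiv (by simp)
  have ck : ∀ t, Continuous (kern ψ x t) := fun t => by unfold kern; fun_prop
  have ck' : Continuous (kernDeriv ψ x t) := by unfold kernDeriv; fun_prop
  -- On the neighbourhood r > t/2 all powers of r⁻¹ are dominated by those of τ, which gives an
  -- integrable bound independent of r.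
  let τ := (t / 2)⁻¹
  have hτ : 0 < τ := by positivity
  have hmeas : ∀ t, AEStronglyMeasurable (fun z => f z * kern ψ x t z) (unif d) :=
    fun t => hf.1.mul (ck t).aestronglyMeasurable
  refine hasDerivAt_integral_of_dominated_loc_of_deriv_le (s := Set.Ioi (t / 2))
    (F := fun t z => f z * kern ψ x t z) (F' := fun t z => f z * kernDeriv ψ x t z)
    (bound := fun z => ‖f z‖ * (d * τ ^ (d + 1) * B + τ ^ (d + 2) * B'))
    (Ioi_mem_nhds (by linarith)) (.of_forall hmeas) ?_ ?_ ?_ ?_ ?_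
  · refine hf.mul_bdd (c := t⁻¹ ^ d * B) (ck t).aestronglyMeasurable (.of_forall fun z => ?_)
    rw [kern, Real.norm_eq_abs, abs_mul, abs_of_nonneg (by positivity)]
    gcongr
    exact hB _
  · exact hf.1.mul ck'.aestronglyMeasurable
  · filter_upwards [ae_mem_cube d] with z hz r hr
    rw [norm_mul]
    gcongr
    have hr0 : 0 < r := lt_trans (by positivity) hr
    have hle : r⁻¹ ≤ τ := inv_anti₀ (by positivity) (le_of_lt hr)
    rw [kernDeriv, norm_neg]
    refine (norm_add_le _ _).trans ?_
    rw [norm_mul, norm_mul, norm_mul]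
    have e1 : ‖(d : ℝ)‖ = d := by simp
    have e2 : ∀ k, ‖r⁻¹ ^ k‖ = r⁻¹ ^ k := fun k => by
      rw [Real.norm_eq_abs, abs_of_nonneg (by positivity)]
    rw [e1, e2, e2]
    have h3 : ‖(fderiv ℝ ψ (x + r⁻¹ • (z - x))) (z - x)‖ ≤ B' := by
      refine (ContinuousLinearMap.le_opNorm _ _).trans ?_
      calc _ ≤ B' * 1 := by
            gcongr
            · exact hB' _
            · exact norm_sub_le_one_of_mem_cube hx hz
        _ = B' := mul_one _
    gcongr
    exact hB _
  · exact hf.norm.mul_const _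
  · refine .of_forall fun z r hr => ?_
    have hr0 : 0 < r := lt_trans (by positivity) hr
    exact (hasDerivAt_kern hd x z hr0.ne').const_mul _

lemma continuousOn_avg {ψ : (Fin d → ℝ) → ℝ} (h : IsTestFunction ψ) {f : (Fin d → ℝ) → ℝ}
    (hf : Integrable f (unif d)) {x : Fin d → ℝ} (hx : x ∈ cube d) :
    ContinuousOn (avg f ψ x) (Set.Ioi 0) :=
  fun _ ht => (hasDerivAt_avg h hf hx ht).2.continuousAt.continuousWithinAt

/-- The derivative of the averages in terms of weak partial derivatives. -/
lemma hasDerivAt_avg_of_weak {ψ : (Fin d → ℝ) → ℝ} (h : IsTestFunction ψ)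
    {f : (Fin d → ℝ) → ℝ} {g : Fin d → (Fin d → ℝ) → ℝ} (hf : Integrable f (unif d))
    (hg : ∀ i φ, IsTestFunction φ →
      ∫ x, f x * partialDeriv i φ x ∂(unif d) = - ∫ x, g i x * φ x ∂(unif d))
    {x : Fin d → ℝ} (hx : x ∈ cube d) {t : ℝ} (h0 : 0 < t) (h1 : t ≤ 1) :
    HasDerivAt (avg f ψ x) (∑ i, avg (g i) (tilt x i ψ) x t) t := by
  refine (hasDerivAt_avg h hf hx h0).2.congr_deriv ?_
  have hd : Differentiable ℝ ψ := h.1.differentiable (by simp)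
  have e : ∀ z, f z * kernDeriv ψ x t z =
      -∑ i, f z * partialDeriv i (kern (tilt x i ψ) x t) z := fun z => by
    rw [← Finset.mul_sum, sum_partialDeriv_kern_tilt hd]; ring
  simp_rw [e]
  have hT : ∀ i, IsTestFunction (partialDeriv i (kern (tilt x i ψ) x t)) :=
    fun i => ((h.tilt x i).kern hx h0 h1).partialDeriv i
  rw [integral_neg, integral_finsetSum, ← Finset.sum_neg_distrib]
  · refine Finset.sum_congr rfl fun i _ => ?_
    rw [hg i _ ((h.tilt x i).kern hx h0 h1), neg_neg, avg]
  · intro i _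
    obtain ⟨B, hB⟩ := (hT i).exists_bound
    exact hf.mul_bdd (hT i).1.continuous.aestronglyMeasurable (.of_forall hB)

/-! ### Averages over boxes contracted towards a point -/

lemma lintegral_comp_affine (a : Fin d → ℝ) {t : ℝ} (ht : 0 < t) {H : (Fin d → ℝ) → ℝ≥0∞}
    (hH : Measurable H) :
    ∫⁻ y, H (a + t • y) = ENNReal.ofReal (t⁻¹ ^ d) * ∫⁻ z, H z := by
  have h1 : ∫⁻ y, H (a + t • y) = ∫⁻ z, H (a + z) ∂(Measure.map (t • ·) volume) := by
    rw [lintegral_map (by fun_prop) (by fun_prop)]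
  rw [h1, Measure.map_addHaar_smul _ ht.ne', lintegral_smul_measure,
    lintegral_add_left_eq_self (fun z => H z) a]
  rw [abs_of_pos (by positivity)]
  simp [inv_pow]

/-- Averages of `F` over the cubes `x + t ([0,1]^d - x)`. -/
def boxAvg (F : (Fin d → ℝ) → ℝ≥0∞) (x : Fin d → ℝ) (t : ℝ) : ℝ≥0∞ :=
  ∫⁻ y, F (x + t • (y - x)) ∂(unif d)

lemma lintegral_affine_unif_le {a : Fin d → ℝ} {t : ℝ} (ht : 0 < t)
    (hat : ∀ y ∈ cube d, a + t • y ∈ cube d) {H : (Fin d → ℝ) → ℝ≥0∞} (hH : Measurable H) :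
    ∫⁻ y, H (a + t • y) ∂(unif d) ≤ ENNReal.ofReal (t⁻¹ ^ d) * ∫⁻ z, H z ∂(unif d) := by
  have hi : Measurable ((cube d).indicator H) := hH.indicator (measurableSet_cube d)
  calc ∫⁻ y, H (a + t • y) ∂(unif d)
      = ∫⁻ y in cube d, (cube d).indicator H (a + t • y) :=
        setLIntegral_congr_fun (measurableSet_cube d) fun y hy => by
          simp [Set.indicator_of_mem (hat y hy)]
    _ ≤ ∫⁻ y, (cube d).indicator H (a + t • y) := setLIntegral_le_lintegral _ _
    _ = _ := by
        rw [lintegral_comp_affine a ht hi, lintegral_indicator (measurableSet_cube d)]; rfl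

/-- The substitution z = x + t(y - x) cancels the factor t^{-d} of the kernel, and ψ restricts y to
the cube. -/
lemma enorm_avg_le {f ψ : (Fin d → ℝ) → ℝ} (h : IsTestFunction ψ) {B : ℝ} (hB : ∀ y, |ψ y| ≤ B)
    {F : (Fin d → ℝ) → ℝ≥0∞} (hF : Measurable F) (hfF : ∀ z, ‖f z‖ₑ ≤ F z) {x : Fin d → ℝ} {t : ℝ}
    (h0 : 0 < t) :
    ‖avg f ψ x t‖ₑ ≤ ENNReal.ofReal B * boxAvg F x t := by
  let H : (Fin d → ℝ) → ℝ≥0∞ := fun y => (cube d).indicator (fun y => F (x + t • (y - x))) y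
  have hH : Measurable H := Measurable.indicator (by fun_prop) (measurableSet_cube d)
  have hc := lintegral_comp_affine (x - t⁻¹ • x) (inv_pos.2 h0) hH
  have hb : boxAvg F x t = ∫⁻ y, H y := by
    rw [lintegral_indicator (measurableSet_cube d)]; rfl
  calc ‖avg f ψ x t‖ₑ ≤ ∫⁻ z, ‖f z * kern ψ x t z‖ₑ ∂(unif d) := enorm_integral_le_lintegral_enorm _
    _ ≤ ∫⁻ z, ‖f z * kern ψ x t z‖ₑ := setLIntegral_le_lintegral _ _
    _ ≤ ∫⁻ z, ENNReal.ofReal (t⁻¹ ^ d * B) * H (x - t⁻¹ • x + t⁻¹ • z) := by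
        refine lintegral_mono fun z => ?_
        have e : x - t⁻¹ • x + t⁻¹ • z = x + t⁻¹ • (z - x) := by rw [smul_sub]; abel
        simp only [e, H]
        by_cases hz : x + t⁻¹ • (z - x) ∈ cube d
        · rw [Set.indicator_of_mem hz]
          have e2 : x + t • (x + t⁻¹ • (z - x) - x) = z := by simp [smul_smul, h0.ne']
          rw [e2, enorm_mul, mul_comm]
          gcongr
          · rw [Real.enorm_eq_ofReal_abs, kern, abs_mul, abs_of_nonneg (by positivity)]
            gcongr
            exact hB _
          · exact hfF z
        · simp [kern, h.eq_zero hz]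
    _ = ENNReal.ofReal B * boxAvg F x t := by
        rw [lintegral_const_mul _ (by fun_prop), hc, hb, inv_inv, ← mul_assoc,
          ← ENNReal.ofReal_mul' (by positivity)]
        rw [inv_pow, mul_right_comm, inv_mul_cancel₀ (by positivity), one_mul]

/-! ### Iterating over the order of the derivatives -/

/-- A family `D` of weak derivatives of order at most `s`, dominated by a function `F` whose
averages over cubes of side length `t` are at most `Λ t^{-κ}`. -/
structure IsDominatedFamily (s : ℕ) (κ Λ : ℝ) (D : (Fin d → ℕ) → (Fin d → ℝ) → ℝ)
    (F : (Fin d → ℝ) → ℝ≥0∞) : Prop where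
  integrable : ∀ α, ∑ i, α i ≤ s → Integrable (D α) (unif d)
  weak : ∀ α i, ∑ j, α j + 1 ≤ s → ∀ φ, IsTestFunction φ →
    ∫ x, D α x * partialDeriv i φ x ∂(unif d) = -∫ x, D (α + Pi.single i 1) x * φ x ∂(unif d)
  measurable : Measurable F
  le : ∀ α, ∑ i, α i ≤ s → ∀ z, ‖D α z‖ₑ ≤ F z
  nonneg : 0 ≤ Λ
  boxAvg_le : ∀ x ∈ cube d, ∀ t, 0 < t → t ≤ 1 → boxAvg F x t ≤ ENNReal.ofReal (Λ * t ^ (-κ))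

namespace IsDominatedFamily

variable {s : ℕ} {κ Λ : ℝ} {D : (Fin d → ℕ) → (Fin d → ℝ) → ℝ} {F : (Fin d → ℝ) → ℝ≥0∞}

/-- The fundamental theorem of calculus in the scale variable; the derivative consists of averages
of derivatives one order higher. -/
lemma enorm_avg_le_add (H : IsDominatedFamily s κ Λ D F) {ψ : (Fin d → ℝ) → ℝ}
    (hψ : IsTestFunction ψ) {x : Fin d → ℝ} (hx : x ∈ cube d) {α : Fin d → ℕ}
    (hα : ∑ i, α i + 1 ≤ s) {ε h : ℝ} (h0 : 0 < ε) (hεh : ε ≤ h) (h1 : h ≤ 1) :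
    ‖avg (D α) ψ x ε‖ₑ ≤ ‖avg (D α) ψ x h‖ₑ +
      ∫⁻ t in Set.Ioc ε h, ∑ i, ‖avg (D (α + Pi.single i 1)) (tilt x i ψ) x t‖ₑ := by
  have hI : ∀ i, Integrable (D (α + Pi.single i 1)) (unif d) := fun i =>
    H.integrable _ (by rw [sum_add_single]; exact hα)
  have hsub : Set.uIcc ε h ⊆ Set.Ioi 0 := by
    rw [Set.uIcc_of_le hεh]; exact fun t ht => h0.trans_le ht.1
  have key := intervalIntegral.integral_eq_sub_of_hasDerivAt (a := ε) (b := h)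
    (f := avg (D α) ψ x) (f' := fun t => ∑ i, avg (D (α + Pi.single i 1)) (tilt x i ψ) x t)
    (fun t ht => by
      have ht' := ht
      rw [Set.uIcc_of_le hεh] at ht'
      exact hasDerivAt_avg_of_weak hψ (H.integrable α (by omega)) (fun i => H.weak α i hα) hx
        (hsub ht) (ht'.2.trans h1))
    (ContinuousOn.intervalIntegrable (continuousOn_finsetSum _ fun i _ =>
      (continuousOn_avg (hψ.tilt x i) (hI i) hx).mono hsub))
  have e : avg (D α) ψ x ε = avg (D α) ψ x h -
      ∫ t in ε..h, ∑ i, avg (D (α + Pi.single i 1)) (tilt x i ψ) x t := by rw [key]; ring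
  rw [e]
  refine (enorm_sub_le).trans (add_le_add le_rfl ?_)
  rw [intervalIntegral.integral_of_le hεh]
  refine (enorm_integral_le_lintegral_enorm _).trans (lintegral_mono fun t => ?_)
  exact enorm_sum_le _ _

lemma lintegral_Ioc_rpow_le {κ : ℝ} {k : ℕ} (hk : (k : ℝ) + 1 < κ) {h : ℝ} (h0 : 0 < h)
    (h1 : h ≤ 1) {c : ℝ} (hc : 0 ≤ c) :
    ∫⁻ t in Set.Ioc h 1, ENNReal.ofReal (c * t ^ ((k : ℝ) - κ)) ≤
      ENNReal.ofReal (c / (κ - k - 1) * h ^ ((k : ℝ) + 1 - κ)) := by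
  have hmem : (0 : ℝ) ∉ Set.uIcc h 1 := by
    rw [Set.uIcc_of_le h1]; exact fun hh => absurd hh.1 (not_le.2 h0)
  have hint : IntervalIntegrable (fun t : ℝ => c * t ^ ((k : ℝ) - κ)) volume h 1 :=
    (intervalIntegral.intervalIntegrable_rpow (Or.inr hmem)).const_mul c
  rw [← ofReal_integral_eq_lintegral_ofReal
    ((intervalIntegrable_iff_integrableOn_Ioc_of_le h1).1 hint)]
  · refine ENNReal.ofReal_le_ofReal ?_
    rw [← intervalIntegral.integral_of_le h1, intervalIntegral.integral_const_mul,
      integral_rpow (Or.inr ⟨by linarith, hmem⟩)]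
    have e : (k : ℝ) - κ + 1 = k + 1 - κ := by ring
    rw [e, Real.one_rpow, div_mul_eq_mul_div, mul_div_assoc]
    refine mul_le_mul_of_nonneg_left ?_ hc
    rw [← neg_div_neg_eq, neg_sub, show -((k : ℝ) + 1 - κ) = κ - k - 1 by ring]
    have : 0 < κ - k - 1 := by linarith
    gcongr
    linarith
  · filter_upwards [ae_restrict_mem measurableSet_Ioc] with t ht
    have := h0.trans ht.1
    positivity

/-- Averages of weak derivatives at scale `h` are bounded by `h^{k - κ}`, `k` being the number of
further derivatives in the family. -/
lemma exists_enorm_avg_le (d : ℕ) (κ : ℝ) (k : ℕ) (hk : (k : ℝ) < κ) :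
    ∃ C : ℝ, 0 ≤ C ∧ ∀ (s : ℕ) (Λ : ℝ) (D : (Fin d → ℕ) → (Fin d → ℝ) → ℝ)
      (F : (Fin d → ℝ) → ℝ≥0∞), IsDominatedFamily s κ Λ D F → ∀ (ψ : (Fin d → ℝ) → ℝ) (B : ℝ),
      IsTestFunction ψ → (∀ y, |ψ y| ≤ B) → ∀ x ∈ cube d, ∀ α, ∑ i, α i + k = s →
      ∀ h, 0 < h → h ≤ 1 →
      ‖avg (D α) ψ x h‖ₑ ≤ ENNReal.ofReal (C * (B * Λ) * h ^ ((k : ℝ) - κ)) := by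
  induction k with
  | zero =>
    refine ⟨1, zero_le_one, fun s Λ D F H ψ B hψ hB x hx α hα h h0 h1 => ?_⟩
    have hB0 : 0 ≤ B := (abs_nonneg _).trans (hB 0)
    refine (enorm_avg_le hψ hB H.measurable (H.le α (by omega)) h0).trans ?_
    refine (mul_le_mul_right (H.boxAvg_le x hx h h0 h1) _).trans ?_
    rw [← ENNReal.ofReal_mul hB0]
    simp [mul_assoc]
  | succ k ih =>
    push_cast at hk
    obtain ⟨C, hC, ih⟩ := ih (by linarith)
    have hden : 0 < κ - k - 1 := by linarith
    -- The 1 pays for the average at scale 1. The other term comes from integrating the inductive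
    -- bound d C t^{k-κ} over (h, 1]; as k - κ < -1, the lower end dominates.
    refine ⟨1 + d * C / (κ - k - 1), by positivity,
      fun s Λ D F H ψ B hψ hB x hx α hα h h0 h1 => ?_⟩
    have hB0 : 0 ≤ B := (abs_nonneg _).trans (hB 0)
    have hΛ := H.nonneg
    refine (H.enorm_avg_le_add hψ hx (α := α) (by omega) h0 h1 le_rfl).trans ?_
    have b1 : ‖avg (D α) ψ x 1‖ₑ ≤ ENNReal.ofReal (B * Λ * h ^ ((k : ℝ) + 1 - κ)) := by
      refine (enorm_avg_le hψ hB H.measurable (H.le α (by omega)) one_pos).trans ?_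
      refine (mul_le_mul_right (H.boxAvg_le x hx 1 one_pos le_rfl) _).trans ?_
      rw [← ENNReal.ofReal_mul hB0, Real.one_rpow, mul_one]
      refine ENNReal.ofReal_le_ofReal (le_mul_of_one_le_right (by positivity) ?_)
      exact Real.one_le_rpow_of_pos_of_le_one_of_nonpos h0 h1 (by linarith)
    have b2 : ∫⁻ t in Set.Ioc h 1, ∑ i, ‖avg (D (α + Pi.single i 1)) (tilt x i ψ) x t‖ₑ ≤
        ENNReal.ofReal (d * C * (B * Λ) / (κ - k - 1) * h ^ ((k : ℝ) + 1 - κ)) := by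
      refine le_trans (setLIntegral_mono' measurableSet_Ioc fun t ht => ?_)
        (lintegral_Ioc_rpow_le hk h0 h1 (c := d * C * (B * Λ)) (by positivity))
      refine (Finset.sum_le_card_nsmul _ _ _ fun i _ => ih s Λ D F H _ B (hψ.tilt x i)
        (abs_tilt_le hψ hx i hB) x hx _ (by rw [sum_add_single]; omega) t (h0.trans ht.1)
        ht.2).trans ?_
      rw [Finset.card_univ, Fintype.card_fin, ← ENNReal.ofReal_nsmul, nsmul_eq_mul]
      refine ENNReal.ofReal_le_ofReal (le_of_eq (by ring))
    refine (add_le_add b1 b2).trans ?_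
    have := Real.rpow_nonneg h0.le ((k : ℝ) + 1 - κ)
    rw [← ENNReal.ofReal_add (by positivity) (by positivity)]
    refine ENNReal.ofReal_le_ofReal (le_of_eq ?_)
    push_cast
    field_simp

/-- The recursion now starts at a tiny scale ε and stops at h instead of 1; the averages at scale h
are bounded by `exists_enorm_avg_le`. At the top order the box average is kept under the integral,
because t^{-κ} is not integrable at 0. The bound no longer involves ε, so ε may tend to 0. -/
lemma exists_enorm_avg_le_add (d : ℕ) (κ : ℝ) (k : ℕ) (hk : (k : ℝ) + 1 < κ) :
    ∃ C : ℝ, 0 ≤ C ∧ ∀ (s : ℕ) (Λ : ℝ) (D : (Fin d → ℕ) → (Fin d → ℝ) → ℝ)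
      (F : (Fin d → ℝ) → ℝ≥0∞), IsDominatedFamily s κ Λ D F → ∀ (ψ : (Fin d → ℝ) → ℝ) (B : ℝ),
      IsTestFunction ψ → (∀ y, |ψ y| ≤ B) → ∀ x ∈ cube d, ∀ α, ∑ i, α i + (k + 1) = s →
      ∀ ε h, 0 < ε → ε ≤ h → h ≤ 1 →
      ‖avg (D α) ψ x ε‖ₑ ≤ ENNReal.ofReal (C * (B * Λ) * h ^ ((k : ℝ) + 1 - κ)) +
        ENNReal.ofReal (C * B * h ^ k) * ∫⁻ t in Set.Ioc 0 h, boxAvg F x t := by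
  induction k with
  | zero =>
    obtain ⟨A, hA, hAb⟩ := exists_enorm_avg_le d κ 1 (by simpa using hk)
    push_cast at hAb
    refine ⟨A + d, by positivity, fun s Λ D F H ψ B hψ hB x hx α hα ε h h0 hεh h1 => ?_⟩
    have hB0 : 0 ≤ B := (abs_nonneg _).trans (hB 0)
    have hΛ := H.nonneg
    have hh := h0.trans_le hεh
    refine (H.enorm_avg_le_add hψ hx (α := α) (by omega) h0 hεh h1).trans (add_le_add ?_ ?_)
    · refine (hAb s Λ D F H ψ B hψ hB x hx α (by omega) h hh h1).trans ?_
      refine ENNReal.ofReal_le_ofReal ?_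
      rw [Nat.cast_zero, zero_add]
      gcongr
      linarith [(Nat.cast_nonneg d : (0 : ℝ) ≤ d)]
    · calc ∫⁻ t in Set.Ioc ε h, ∑ i, ‖avg (D (α + Pi.single i 1)) (tilt x i ψ) x t‖ₑ
          ≤ ∫⁻ t in Set.Ioc ε h, ENNReal.ofReal (d * B) * boxAvg F x t := by
            refine setLIntegral_mono' measurableSet_Ioc fun t ht => ?_
            refine (Finset.sum_le_card_nsmul _ _ _ fun i _ => enorm_avg_le (hψ.tilt x i)
              (abs_tilt_le hψ hx i hB) H.measurable
              (H.le _ (by rw [sum_add_single]; omega)) (h0.trans ht.1)).trans ?_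
            rw [Finset.card_univ, Fintype.card_fin, nsmul_eq_mul, ← mul_assoc,
              ENNReal.ofReal_mul (by positivity), ENNReal.ofReal_natCast]
        _ ≤ ∫⁻ t in Set.Ioc 0 h, ENNReal.ofReal (d * B) * boxAvg F x t :=
            lintegral_mono_set (Set.Ioc_subset_Ioc_left h0.le)
        _ = ENNReal.ofReal (d * B) * ∫⁻ t in Set.Ioc 0 h, boxAvg F x t :=
            lintegral_const_mul' _ _ ENNReal.ofReal_ne_top
        _ ≤ _ := by
            refine mul_le_mul_left (ENNReal.ofReal_le_ofReal ?_) _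
            rw [pow_zero, mul_one]
            nlinarith
  | succ k ih =>
    push_cast at hk
    obtain ⟨A, hA, hAb⟩ := exists_enorm_avg_le d κ (k + 1 + 1) (by push_cast; exact hk)
    push_cast at hAb
    obtain ⟨C, hC, ih⟩ := ih (by linarith)
    refine ⟨A + d * C, by positivity, fun s Λ D F H ψ B hψ hB x hx α hα ε h h0 hεh h1 => ?_⟩
    have hB0 : 0 ≤ B := (abs_nonneg _).trans (hB 0)
    have hΛ := H.nonneg
    have hh := h0.trans_le hεh
    set W := ∫⁻ t in Set.Ioc 0 h, boxAvg F x t with hW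
    refine (H.enorm_avg_le_add hψ hx (α := α) (by omega) h0 hεh h1).trans ?_
    have b1 := hAb s Λ D F H ψ B hψ hB x hx α (by omega) h hh h1
    have hpow : h * h ^ ((k : ℝ) + 1 - κ) = h ^ ((k : ℝ) + 1 + 1 - κ) := by
      rw [show (k : ℝ) + 1 + 1 - κ = 1 + (k + 1 - κ) by ring, Real.rpow_add hh, Real.rpow_one]
    have hpn := Real.rpow_nonneg hh.le ((k : ℝ) + 1 - κ)
    have hpn' := Real.rpow_nonneg hh.le ((k : ℝ) + 1 + 1 - κ)
    have b2 : ∫⁻ t in Set.Ioc ε h, ∑ i, ‖avg (D (α + Pi.single i 1)) (tilt x i ψ) x t‖ₑ ≤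
        ENNReal.ofReal (d * C * (B * Λ) * h ^ ((k : ℝ) + 1 + 1 - κ)) +
        ENNReal.ofReal (d * C * B * h ^ (k + 1)) * W := by
      calc ∫⁻ t in Set.Ioc ε h, ∑ i, ‖avg (D (α + Pi.single i 1)) (tilt x i ψ) x t‖ₑ
          -- The inductive bound is applied between the scales t and h and does not depend on t, so
          -- integrating it costs a factor of at most h.
          ≤ ∫⁻ _ in Set.Ioc ε h, d * (ENNReal.ofReal (C * (B * Λ) * h ^ ((k : ℝ) + 1 - κ)) +
              ENNReal.ofReal (C * B * h ^ k) * W) := by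
            refine setLIntegral_mono' measurableSet_Ioc fun t ht => ?_
            have ht0 := h0.trans ht.1
            refine (Finset.sum_le_card_nsmul _ _ _ fun i _ => ih s Λ D F H _ B (hψ.tilt x i)
              (abs_tilt_le hψ hx i hB) x hx _ (by rw [sum_add_single]; omega) t h ht0 ht.2
              h1).trans ?_
            rw [Finset.card_univ, Fintype.card_fin, nsmul_eq_mul]
        _ ≤ d * (ENNReal.ofReal (C * (B * Λ) * h ^ ((k : ℝ) + 1 - κ)) +
              ENNReal.ofReal (C * B * h ^ k) * W) * ENNReal.ofReal h := by
            rw [setLIntegral_const, Real.volume_Ioc]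
            gcongr
            linarith
        _ = _ := by
            have e1 : d * ENNReal.ofReal (C * (B * Λ) * h ^ ((k : ℝ) + 1 - κ)) * ENNReal.ofReal h =
                ENNReal.ofReal (d * C * (B * Λ) * h ^ ((k : ℝ) + 1 + 1 - κ)) := by
              rw [← ENNReal.ofReal_natCast d, ← ENNReal.ofReal_mul (by positivity),
                ← ENNReal.ofReal_mul (by positivity), ← hpow]
              congr 1
              ring
            have e2 : d * ENNReal.ofReal (C * B * h ^ k) * ENNReal.ofReal h =
                ENNReal.ofReal (d * C * B * h ^ (k + 1)) := by
              rw [← ENNReal.ofReal_natCast d, ← ENNReal.ofReal_mul (by positivity),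
                ← ENNReal.ofReal_mul (by positivity)]
              congr 1
              ring
            rw [← e1, ← e2]
            ring
    refine (add_le_add b1 b2).trans ?_
    push_cast
    rw [← add_assoc, ← ENNReal.ofReal_add (by positivity) (by positivity)]
    gcongr
    · refine le_of_eq (by ring)
    · exact le_add_of_nonneg_left hA

end IsDominatedFamily

/-! ### Recovering the function from its averages -/

/-- The centre of the unit cube. -/
def center (d : ℕ) : Fin d → ℝ := fun _ => 1 / 2

lemma mem_cube_iff {x : Fin d → ℝ} : x ∈ cube d ↔ ‖x - center d‖ ≤ 1 / 2 := by
  rw [pi_norm_le_iff_of_nonneg (by norm_num)]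
  simp only [cube, Set.mem_Icc, Pi.le_def, Pi.zero_apply, Pi.one_apply, Pi.sub_apply, center,
    Real.norm_eq_abs, abs_le]
  constructor
  · rintro ⟨h1, h2⟩ i
    constructor <;> linarith [h1 i, h2 i]
  · intro h
    exact ⟨fun i => by linarith [(h i).1], fun i => by linarith [(h i).2]⟩

lemma closedBall_center_subset_openCube :
    Metric.closedBall (center d) (1 / 4) ⊆ openCube d := by
  intro x hx
  rw [mem_closedBall_iff_norm, pi_norm_le_iff_of_nonneg (by norm_num)] at hx
  simp only [openCube, Set.mem_pi, Set.mem_univ, true_implies, Set.mem_Ioo]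
  intro i
  have := hx i
  simp only [Pi.sub_apply, center, Real.norm_eq_abs, abs_le] at this
  constructor <;> linarith

/-- There is a smooth probability density supported well inside the unit cube. -/
lemma exists_mollifier (d : ℕ) : ∃ φ : (Fin d → ℝ) → ℝ, IsTestFunction φ ∧ (∀ y, 0 ≤ φ y) ∧
    ∫ y, φ y = 1 ∧ tsupport φ ⊆ Metric.closedBall (center d) (1 / 4) := by
  let b : ContDiffBump (center d) := ⟨1 / 8, 1 / 4, by norm_num, by norm_num⟩
  have hs : tsupport (b.normed volume) ⊆ Metric.closedBall (center d) (1 / 4) := by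
    rw [b.tsupport_normed_eq]
  exact ⟨b.normed volume, ⟨b.contDiff_normed, b.hasCompactSupport_normed,
    hs.trans closedBall_center_subset_openCube⟩, b.nonneg_normed, b.integral_normed, hs⟩

lemma integral_kern {φ : (Fin d → ℝ) → ℝ} (x : Fin d → ℝ) {t : ℝ} (ht : 0 < t) :
    ∫ z, kern φ x t z = ∫ y, φ y := by
  have e : ∀ z, kern φ x t z = t⁻¹ ^ d * φ ((x - t⁻¹ • x) + t⁻¹ • z) := fun z => by
    rw [kern]
    congr 2
    rw [smul_sub]
    abel
  simp_rw [e]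
  rw [integral_const_mul, Measure.integral_comp_smul volume (fun y => φ ((x - t⁻¹ • x) + y)),
    integral_add_left_eq_self (fun y => φ y) (x - t⁻¹ • x)]
  rw [Module.finrank_fin_fun, abs_of_pos (by positivity), smul_eq_mul, ← mul_assoc,
    mul_inv_cancel₀ (by positivity), one_mul]

/-- The kernel has mass 1, vanishes off the box S of volume ε^d and is at most B ε^{-d} there. In
the sup norm this box is a ball. The indicators turn f into a function on the whole space, where the
differentiation theorem applies. -/
lemma norm_avg_sub_le {φ : (Fin d → ℝ) → ℝ} (hφ : IsTestFunction φ) {B : ℝ}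
    (hB : ∀ y, |φ y| ≤ B) (h1 : ∫ y, φ y = 1) {f : (Fin d → ℝ) → ℝ} (hf : Integrable f (unif d))
    {x : Fin d → ℝ} (hx : x ∈ cube d) {ε : ℝ} (hε0 : 0 < ε) (hε1 : ε ≤ 1) :
    ‖avg f φ x ε - f x‖ ≤
      B * ⨍ z in Metric.closedBall (x + ε • (center d - x)) (ε / 2),
        ‖(cube d).indicator f z - (cube d).indicator f x‖ := by
  set w := x + ε • (center d - x)
  set S := Metric.closedBall w (ε / 2)
  have hk := hφ.kern hx hε0 hε1
  have hzw : ∀ z, z - w = ε • ((x + ε⁻¹ • (z - x)) - center d) := fun z => by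
    simp only [w]
    ext i
    simp only [Pi.sub_apply, Pi.add_apply, Pi.smul_apply, smul_eq_mul]
    field_simp
    ring
  have hmem : ∀ z, z ∈ S ↔ x + ε⁻¹ • (z - x) ∈ cube d := fun z => by
    rw [mem_closedBall_iff_norm, hzw, norm_smul, Real.norm_of_nonneg hε0.le, mem_cube_iff,
      div_eq_mul_one_div, mul_le_mul_iff_right₀ hε0]
  have hScube : S ⊆ cube d := fun z hz => by
    have := convexComb_mem_cube hx ((hmem z).1 hz) hε0.le hε1
    simpa [smul_smul, hε0.ne'] using this
  have hkc : ∫ z, kern φ x ε z ∂(unif d) = 1 := by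
    rw [integral_unif_eq_integral fun z hz => hk.eq_zero hz, integral_kern x hε0, h1]
  obtain ⟨Bk, hBk⟩ := hk.exists_bound
  have i1 : Integrable (fun z => f z * kern φ x ε z) (unif d) :=
    hf.mul_bdd hk.1.continuous.aestronglyMeasurable (.of_forall hBk)
  have i2 : Integrable (fun z => f x * kern φ x ε z) (unif d) :=
    (integrable_const (f x)).mul_bdd hk.1.continuous.aestronglyMeasurable (.of_forall hBk)
  have e : avg f φ x ε - f x = ∫ z, (f z - f x) * kern φ x ε z ∂(unif d) := by
    simp_rw [sub_mul]
    rw [integral_sub i1 i2, integral_const_mul, hkc, mul_one, avg]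
  have e2 : ∫ z, (f z - f x) * kern φ x ε z ∂(unif d) =
      ∫ z in S, (f z - f x) * kern φ x ε z :=
    (setIntegral_eq_of_subset_of_forall_sdiff_eq_zero (measurableSet_cube d) hScube
      (fun z hz => by
        have : x + ε⁻¹ • (z - x) ∉ cube d := fun h => hz.2 ((hmem z).2 h)
        simp [kern, hφ.eq_zero this]))
  have hvol : volume.real S = ε ^ d := by
    simp only [S, Measure.real]
    rw [Real.volume_pi_closedBall _ (by positivity), Fintype.card_fin,
      ENNReal.toReal_ofReal (by positivity)]
    congr 1
    ring
  have hSf : IntegrableOn (fun z => f z - f x) S := by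
    have : IntegrableOn (fun z => f z - f x) (cube d) := hf.sub (integrable_const (f x))
    exact this.mono_set hScube
  rw [e, e2, setAverage_eq, hvol, smul_eq_mul, ← mul_assoc, ← integral_const_mul]
  refine (norm_integral_le_integral_norm _).trans ?_
  refine integral_mono_of_nonneg (.of_forall fun z => norm_nonneg _) ?_ ?_
  · have : IntegrableOn (fun z => B * (ε ^ d)⁻¹ * ‖f z - f x‖) S := hSf.norm.const_mul _
    refine this.congr_fun (fun z hz => ?_) Metric.isClosed_closedBall.measurableSet
    simp [Set.indicator_of_mem (hScube hz), Set.indicator_of_mem hx]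
  · filter_upwards [ae_restrict_mem Metric.isClosed_closedBall.measurableSet] with z hz
    rw [Set.indicator_of_mem (hScube hz), Set.indicator_of_mem hx, norm_mul, mul_comm]
    gcongr
    rw [kern, norm_mul, inv_pow, Real.norm_of_nonneg (by positivity), mul_comm]
    gcongr
    exact hB _

lemma ae_tendsto_avg {φ : (Fin d → ℝ) → ℝ} (hφ : IsTestFunction φ) (h1 : ∫ y, φ y = 1)
    {f : (Fin d → ℝ) → ℝ} (hf : Integrable f (unif d)) :
    ∀ᵐ x ∂(unif d), Filter.Tendsto (avg f φ x) (nhdsWithin 0 (Set.Ioi 0)) (nhds (f x)) := by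
  obtain ⟨B, hB⟩ := hφ.exists_bound
  have hli : LocallyIntegrable ((cube d).indicator f) volume :=
    ((integrable_indicator_iff (measurableSet_cube d)).2 hf).locallyIntegrable
  filter_upwards [ae_mem_cube d, ae_restrict_of_ae
    (IsUnifLocDoublingMeasure.ae_tendsto_average_norm_sub volume hli 1)] with x hx hlim
  have hδ : Filter.Tendsto (fun ε : ℝ => ε / 2) (nhdsWithin 0 (Set.Ioi 0))
      (nhdsWithin 0 (Set.Ioi 0)) := by
    refine tendsto_nhdsWithin_iff.2 ⟨?_, ?_⟩
    · have : Filter.Tendsto (fun ε : ℝ => ε / 2) (nhds 0) (nhds (0 / 2)) :=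
        (continuous_id.div_const 2).tendsto 0
      rw [zero_div] at this
      exact this.mono_left nhdsWithin_le_nhds
    · filter_upwards [self_mem_nhdsWithin] with ε hε
      exact half_pos (Set.mem_Ioi.1 hε)
  -- The balls are not centred at x, but their centres are within ε/2, one radius, of x; this is
  -- what the parameter 1 of the differentiation theorem allows.
  have h2 := hlim (fun ε : ℝ => x + ε • (center d - x)) (fun ε => ε / 2) hδ (by
    filter_upwards [self_mem_nhdsWithin] with ε hε
    rw [Set.mem_Ioi] at hε
    have := mem_cube_iff.1 hx
    rw [mem_closedBall_iff_norm, show x - (x + ε • (center d - x)) = ε • (x - center d) by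
      rw [smul_sub, smul_sub]; abel, norm_smul, Real.norm_of_nonneg hε.le]
    nlinarith)
  rw [tendsto_iff_norm_sub_tendsto_zero]
  have h3 := h2.const_mul B
  rw [mul_zero] at h3
  refine squeeze_zero' (.of_forall fun _ => norm_nonneg _) ?_ h3
  have : Set.Ioc (0 : ℝ) 1 ∈ nhdsWithin (0 : ℝ) (Set.Ioi 0) := Ioc_mem_nhdsGT one_pos
  filter_upwards [this] with ε hε
  exact norm_avg_sub_le hφ hB h1 hf hx hε.1 hε.2

/-- Pointwise splitting of a function with `k + 1` weak derivatives into a bounded part and a part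
controlled by averages of its derivatives. -/
lemma exists_ae_enorm_le (d : ℕ) (κ : ℝ) (k : ℕ) (hk : (k : ℝ) + 1 < κ) :
    ∃ C : ℝ, 0 < C ∧ ∀ (Λ : ℝ) (D : (Fin d → ℕ) → (Fin d → ℝ) → ℝ)
      (F : (Fin d → ℝ) → ℝ≥0∞), IsDominatedFamily (k + 1) κ Λ D F →
      ∀ᵐ x ∂(unif d), ∀ h, 0 < h → h ≤ 1 →
      ‖D 0 x‖ₑ ≤ ENNReal.ofReal (C * Λ * h ^ ((k : ℝ) + 1 - κ)) +
        ENNReal.ofReal (C * h ^ k) * ∫⁻ t in Set.Ioc 0 h, boxAvg F x t := by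
  obtain ⟨φ, hφ, -, h1, -⟩ := exists_mollifier d
  obtain ⟨B, hB⟩ := hφ.exists_bound
  have hB0 : 0 ≤ B := (abs_nonneg _).trans (hB 0)
  obtain ⟨C, hC, hmain⟩ := IsDominatedFamily.exists_enorm_avg_le_add d κ k hk
  refine ⟨C * B + 1, by positivity, fun Λ D F H => ?_⟩
  filter_upwards [ae_mem_cube d, ae_tendsto_avg hφ h1 (H.integrable 0 (by simp))] with x hx hlim
  intro h h0 hh
  have hΛ := H.nonneg
  refine (le_of_tendsto (hlim.enorm) ?_ : ‖D 0 x‖ₑ ≤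
    ENNReal.ofReal (C * (B * Λ) * h ^ ((k : ℝ) + 1 - κ)) +
        ENNReal.ofReal (C * B * h ^ k) * ∫⁻ t in Set.Ioc 0 h, boxAvg F x t).trans ?_
  · have : Set.Ioc (0 : ℝ) h ∈ nhdsWithin (0 : ℝ) (Set.Ioi 0) := Ioc_mem_nhdsGT h0
    filter_upwards [this] with ε hε
    exact hmain (k + 1) Λ D F H φ B hφ hB x hx 0 (by simp) ε h hε.1 hε.2 hh
  · rw [← mul_assoc]
    gcongr <;> linarith

/-! ### L^p bounds for box averages -/

lemma lintegral_rpow_le_mul_lintegral_rpow {Ω : Type*} [MeasurableSpace Ω] (ν : Measure Ω) {p : ℝ}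
    (hp : 1 < p) {G : Ω → ℝ≥0∞} (hG : AEMeasurable G ν) :
    (∫⁻ a, G a ∂ν) ^ p ≤ ν Set.univ ^ (p - 1) * ∫⁻ a, G a ^ p ∂ν := by
  have hc := Real.HolderConjugate.conjExponent hp
  have h := ENNReal.lintegral_mul_le_Lp_mul_Lq ν hc hG (aemeasurable_const (b := (1 : ℝ≥0∞)))
  simp only [Pi.mul_apply, mul_one, ENNReal.one_rpow, lintegral_const, one_mul] at h
  refine (ENNReal.rpow_le_rpow h (by linarith)).trans_eq ?_
  rw [ENNReal.mul_rpow_of_nonneg _ _ (by linarith), ← ENNReal.rpow_mul, ← ENNReal.rpow_mul,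
    one_div_mul_cancel (by linarith), ENNReal.rpow_one, mul_comm]
  congr 2
  rw [Real.conjExponent]
  have : p - 1 ≠ 0 := by linarith
  field_simp

/-- Jensen, followed by a change of variables costing t^{-d} under the p-th root. -/
lemma boxAvg_le_of_lintegral_rpow_le {p : ℝ} (hp : 1 < p) {F : (Fin d → ℝ) → ℝ≥0∞}
    (hF : Measurable F) {Λ : ℝ} (hΛ : 0 ≤ Λ)
    (h : ∫⁻ z, F z ^ p ∂(unif d) ≤ ENNReal.ofReal Λ ^ p) {x : Fin d → ℝ} (hx : x ∈ cube d) {t : ℝ}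
    (h0 : 0 < t) (h1 : t ≤ 1) : boxAvg F x t ≤ ENNReal.ofReal (Λ * t ^ (-(d / p : ℝ))) := by
  have hp0 : 0 < p := by linarith
  rw [← ENNReal.rpow_le_rpow_iff hp0]
  refine (lintegral_rpow_le_mul_lintegral_rpow (unif d) hp (by fun_prop)).trans ?_
  rw [measure_univ, ENNReal.one_rpow, one_mul]
  have e : ∀ y, x + t • (y - x) = (x - t • x) + t • y := fun y => by rw [smul_sub]; abel
  simp_rw [e]
  refine (lintegral_affine_unif_le h0 (fun y hy => ?_) (hF.pow_const p)).trans ?_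
  · rw [← e]
    exact convexComb_mem_cube hx hy h0.le h1
  · refine (mul_le_mul_right h _).trans_eq ?_
    have ht : (0 : ℝ) ≤ t ^ (-(d / p : ℝ)) := by positivity
    rw [ENNReal.ofReal_mul hΛ, ENNReal.mul_rpow_of_nonneg _ _ hp0.le, mul_comm,
      ENNReal.ofReal_rpow_of_nonneg ht hp0.le, ← Real.rpow_mul h0.le]
    congr 2
    rw [neg_mul, div_mul_cancel₀ _ hp0.ne', Real.rpow_neg h0.le, Real.rpow_natCast, inv_pow]

/-- Jensen in t and in y, then Tonelli with x as the innermost variable: for fixed t and y the map x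
↦ x + t(y - x) contracts by 1 - t ≥ 1/2, which is where h ≤ 1/2 and the factor 2^d come from. In
contrast to the pointwise bound, nothing blows up as t tends to 0. -/
lemma lintegral_boxAvg_rpow_le {p : ℝ} (hp : 1 < p) {F : (Fin d → ℝ) → ℝ≥0∞}
    (hF : Measurable F) {h : ℝ} (h0 : 0 < h) (h1 : h ≤ 1 / 2) :
    ∫⁻ x, (∫⁻ t in Set.Ioc 0 h, boxAvg F x t) ^ p ∂(unif d) ≤
      ENNReal.ofReal (2 ^ d * h ^ p) * ∫⁻ z, F z ^ p ∂(unif d) := by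
  set I := ∫⁻ z, F z ^ p ∂(unif d)
  have hp0 : 0 < p := by linarith
  have m3 : Measurable fun q : ((Fin d → ℝ) × ℝ) × (Fin d → ℝ) =>
      F (q.1.1 + q.1.2 • (q.2 - q.1.1)) := by fun_prop
  have m2 : Measurable fun q : (Fin d → ℝ) × ℝ => boxAvg F q.1 q.2 :=
    Measurable.lintegral_prod_right' m3
  calc ∫⁻ x, (∫⁻ t in Set.Ioc 0 h, boxAvg F x t) ^ p ∂(unif d)
      ≤ ∫⁻ x, ENNReal.ofReal h ^ (p - 1) * (∫⁻ t in Set.Ioc 0 h, ∫⁻ y,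
          F (x + t • (y - x)) ^ p ∂(unif d)) ∂(unif d) := by
        refine lintegral_mono fun x => ?_
        refine (lintegral_rpow_le_mul_lintegral_rpow (volume.restrict (Set.Ioc 0 h)) hp
          (m2.comp measurable_prodMk_left).aemeasurable).trans ?_
        rw [Measure.restrict_apply_univ, Real.volume_Ioc, sub_zero]
        refine mul_le_mul_right (lintegral_mono fun t => ?_) _
        refine (lintegral_rpow_le_mul_lintegral_rpow (unif d) hp (by fun_prop)).trans ?_
        rw [measure_univ, ENNReal.one_rpow, one_mul]
    _ = ENNReal.ofReal h ^ (p - 1) * ∫⁻ t in Set.Ioc 0 h, ∫⁻ y, ∫⁻ x,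
          F (x + t • (y - x)) ^ p ∂(unif d) ∂(unif d) := by
        have m4 : Measurable fun q : (Fin d → ℝ) × ℝ =>
            ∫⁻ y, F (q.1 + q.2 • (y - q.1)) ^ p ∂(unif d) :=
          Measurable.lintegral_prod_right' (m3.pow_const p)
        rw [lintegral_const_mul _ (Measurable.lintegral_prod_right' m4),
          lintegral_lintegral_swap m4.aemeasurable]
        congr 1
        refine lintegral_congr fun t => ?_
        rw [lintegral_lintegral_swap]
        exact Measurable.aemeasurable (by fun_prop)
    _ ≤ ENNReal.ofReal h ^ (p - 1) * ∫⁻ _ in Set.Ioc 0 h, ∫⁻ _, ENNReal.ofReal (2 ^ d) * I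
          ∂(unif d) := by
        refine mul_le_mul_right (setLIntegral_mono' measurableSet_Ioc fun t ht => ?_) _
        refine lintegral_mono_ae ?_
        filter_upwards [ae_mem_cube d] with y hy
        have e : ∀ x, x + t • (y - x) = t • y + (1 - t) • x := fun x => by
          rw [smul_sub, sub_smul, one_smul]; abel
        simp_rw [e]
        have ht1 : t ≤ 1 / 2 := ht.2.trans h1
        refine (lintegral_affine_unif_le (by linarith) (fun x hx => ?_) (hF.pow_const p)).trans ?_
        · rw [← e]
          exact convexComb_mem_cube hx hy ht.1.le (by linarith)
        · refine mul_le_mul_left (ENNReal.ofReal_le_ofReal ?_) _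
          have : (1 - t)⁻¹ ≤ 2 := by
            rw [inv_le_comm₀ (by linarith) (by norm_num)]
            linarith
          have : 0 ≤ (1 - t)⁻¹ := inv_nonneg.2 (by linarith)
          gcongr
    _ = _ := by
        rw [setLIntegral_const, lintegral_const, measure_univ, mul_one, Real.volume_Ioc, sub_zero,
          ENNReal.ofReal_rpow_of_pos h0]
        have e : h ^ p = h ^ (p - 1) * h := by
          rw [Real.rpow_sub_one h0.ne']; field_simp
        rw [e, ENNReal.ofReal_mul (by positivity), ENNReal.ofReal_mul (by positivity)]
        ring

/-! ### The weak-type Sobolev inequality -/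

lemma mem_multiIndices {s : ℕ} {α : Fin d → ℕ} : α ∈ multiIndices d s ↔ ∑ i, α i ≤ s := by
  simp only [multiIndices, Finset.mem_filter, Finset.mem_Iic, and_iff_right_iff_imp]
  intro h i
  exact (Finset.single_le_sum (fun j _ => Nat.zero_le (α j)) (Finset.mem_univ i)).trans h

lemma exists_weakDeriv_of_mem_sobolevBall {s : ℕ} {p L : ℝ} (hp : 0 < p)
    {f : (Fin d → ℝ) → ℝ} (hf : f ∈ sobolevBall d s p L) {α : Fin d → ℕ} (hα : ∑ i, α i ≤ s) :
    ∃ g : (Fin d → ℝ) → ℝ, Measurable g ∧ MemLp g (ENNReal.ofReal p) (unif d) ∧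
      IsWeakDeriv α f g ∧ eLpNorm g (ENNReal.ofReal p) (unif d) ≤ ENNReal.ofReal L + 1 := by
  have h1 : derivNorm d p α f ≤ ENNReal.ofReal L := by
    refine le_trans ?_ hf.2
    rw [sobolevNorm, one_div, ENNReal.le_rpow_inv_iff hp]
    exact Finset.single_le_sum (f := fun α => derivNorm d p α f ^ p) (fun _ _ => zero_le)
      (mem_multiIndices.2 hα)
  -- `derivNorm` is an infimum; giving away 1 yields a near-minimiser without invoking uniqueness of
  -- weak derivatives.
  have h2 : derivNorm d p α f < ENNReal.ofReal L + 1 :=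
    h1.trans_lt (ENNReal.lt_add_right ENNReal.ofReal_ne_top one_ne_zero)
  simp only [derivNorm, iInf_lt_iff] at h2
  obtain ⟨g, hg, hw, hlt⟩ := h2
  have hae := hg.1.ae_eq_mk
  refine ⟨hg.1.mk g, hg.1.stronglyMeasurable_mk.measurable, (memLp_congr_ae hae).1 hg, ?_, ?_⟩
  · intro φ hφ
    rw [hw φ hφ]
    congr 1
    refine integral_congr_ae ?_
    filter_upwards [hae] with x hx
    rw [hx]
  · rw [← eLpNorm_congr_ae hae]
    exact hlt.le

/-- The fundamental lemma of the calculus of variations. It is needed because the member of order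
zero of the chosen family is merely some weak derivative of order zero. -/
lemma ae_eq_of_isWeakDeriv_zero {f g : (Fin d → ℝ) → ℝ} (hf : Integrable f (unif d))
    (hg : Integrable g (unif d)) (h : IsWeakDeriv 0 f g) : f =ᵐ[unif d] g := by
  have hi : IntegrableOn (fun x => f x - g x) (openCube d) := by
    have := hf.sub hg
    rw [unif_eq_restrict_openCube] at this
    exact this
  have key := (isOpen_openCube d).ae_eq_zero_of_integral_contDiff_smul_eq_zero
    hi.locallyIntegrableOn (fun φ h1 h2 h3 => by
      have hφ : IsTestFunction φ := ⟨h1, h2, h3⟩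
      obtain ⟨B, hB⟩ := hφ.exists_bound
      have h4 := h φ hφ
      rw [multiDeriv_zero] at h4
      simp only [Pi.zero_apply, Finset.sum_const_zero, pow_zero, one_mul] at h4
      have e : ∀ x, φ x • (f x - g x) = f x * φ x - g x * φ x := fun x => by
        rw [smul_eq_mul]; ring
      simp_rw [e]
      rw [← integral_unif_eq_integral (fun x hx => by simp [hφ.eq_zero hx]), integral_sub
        (hf.mul_bdd hφ.1.continuous.aestronglyMeasurable (.of_forall hB))
        (hg.mul_bdd hφ.1.continuous.aestronglyMeasurable (.of_forall hB)), h4, sub_self])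
  rw [unif_eq_restrict_openCube]
  filter_upwards [(ae_restrict_iff' (isOpen_openCube d).measurableSet).2 key] with x hx
  linarith

lemma lintegral_enorm_rpow_le {Ω : Type*} [MeasurableSpace Ω] {ν : Measure Ω} {p : ℝ} (hp : 0 < p)
    {g : Ω → ℝ} {R : ℝ≥0∞} (h : eLpNorm g (ENNReal.ofReal p) ν ≤ R) :
    ∫⁻ z, ‖g z‖ₑ ^ p ∂ν ≤ R ^ p := by
  rw [eLpNorm_eq_lintegral_rpow_enorm_toReal (by simpa using hp) ENNReal.ofReal_ne_top,
    ENNReal.toReal_ofReal hp.le, one_div, ENNReal.rpow_inv_le_iff hp] at h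
  exact h

/-- The weak derivatives of a function in a Sobolev ball form a dominated family. -/
lemma exists_isDominatedFamily (d s : ℕ) {p L : ℝ} (hp : 1 < p) (hL : 0 < L) :
    ∃ Λ : ℝ, 0 < Λ ∧ ∀ f ∈ sobolevBall d s p L,
      ∃ (D : (Fin d → ℕ) → (Fin d → ℝ) → ℝ) (F : (Fin d → ℝ) → ℝ≥0∞),
        f =ᵐ[unif d] D 0 ∧ IsDominatedFamily s (d / p) Λ D F ∧
        ∫⁻ z, F z ^ p ∂(unif d) ≤ ENNReal.ofReal Λ ^ p := by
  have hp0 : 0 < p := by linarith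
  have hp1 : 1 ≤ ENNReal.ofReal p := by
    rw [← ENNReal.ofReal_one]; exact ENNReal.ofReal_le_ofReal hp.le
  have hcard : 0 < (multiIndices d s).card :=
    Finset.card_pos.2 ⟨0, mem_multiIndices.2 (by simp)⟩
  -- F is the sum of the |D^α f|, each of L^p norm at most L + 1; the power mean inequality gives
  -- the factor `card`.
  refine ⟨(multiIndices d s).card * (L + 1), by positivity, fun f hf => ?_⟩
  choose! D hDm hDp hDw hDn using
    fun (α : Fin d → ℕ) (hα : ∑ i, α i ≤ s) => exists_weakDeriv_of_mem_sobolevBall hp0 hf hα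
  let F : (Fin d → ℝ) → ℝ≥0∞ := fun z => ∑ α ∈ multiIndices d s, ‖D α z‖ₑ
  have hF : Measurable F :=
    Finset.measurable_sum _ fun α hα => (hDm α (mem_multiIndices.1 hα)).enorm
  have hFp : ∫⁻ z, F z ^ p ∂(unif d) ≤
      ENNReal.ofReal ((multiIndices d s).card * (L + 1)) ^ p := by
    calc ∫⁻ z, F z ^ p ∂(unif d)
        ≤ ∫⁻ z, ((multiIndices d s).card : ℝ≥0∞) ^ (p - 1) *
            ∑ α ∈ multiIndices d s, ‖D α z‖ₑ ^ p ∂(unif d) :=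
          lintegral_mono fun z => ENNReal.rpow_sum_le_const_mul_sum_rpow _ _ hp.le
      _ = ((multiIndices d s).card : ℝ≥0∞) ^ (p - 1) *
            ∑ α ∈ multiIndices d s, ∫⁻ z, ‖D α z‖ₑ ^ p ∂(unif d) := by
          have hm : ∀ α ∈ multiIndices d s, Measurable fun z => ‖D α z‖ₑ ^ p :=
            fun α hα => ((hDm α (mem_multiIndices.1 hα)).enorm).pow_const p
          rw [lintegral_const_mul _ (Finset.measurable_fun_sum _ hm), lintegral_finsetSum _ hm]
      _ ≤ ((multiIndices d s).card : ℝ≥0∞) ^ (p - 1) *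
            ((multiIndices d s).card • (ENNReal.ofReal L + 1) ^ p) := by
          gcongr
          exact Finset.sum_le_card_nsmul _ _ _ fun α hα =>
            lintegral_enorm_rpow_le hp0 (hDn α (mem_multiIndices.1 hα))
      _ = _ := by
          rw [ENNReal.ofReal_mul (by positivity), ENNReal.ofReal_natCast,
            ENNReal.ofReal_add hL.le zero_le_one, ENNReal.ofReal_one,
            ENNReal.mul_rpow_of_nonneg _ _ hp0.le, nsmul_eq_mul, ← mul_assoc]
          congr 1
          have hc0 : ((multiIndices d s).card : ℝ≥0∞) ≠ 0 := by exact_mod_cast hcard.ne'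
          rw [ENNReal.rpow_sub _ _ hc0 (ENNReal.natCast_ne_top _), ENNReal.rpow_one,
            ENNReal.div_mul_cancel hc0 (ENNReal.natCast_ne_top _)]
  refine ⟨D, F, ?_, ⟨?_, ?_, hF, ?_, by positivity, ?_⟩, hFp⟩
  · exact ae_eq_of_isWeakDeriv_zero (hf.1.1.integrable hp1)
      ((hDp 0 (by simp)).integrable hp1) (hDw 0 (by simp))
  · exact fun α hα => (hDp α hα).integrable hp1
  · intro α i hα φ hφ
    exact integral_weakDeriv_partialDeriv (hDw α (by omega))
      (hDw _ (by rw [sum_add_single]; exact hα)) hφ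
  · intro α hα z
    exact Finset.single_le_sum (f := fun α => ‖D α z‖ₑ) (fun _ _ => zero_le)
      (mem_multiIndices.2 hα)
  · intro x hx t h0 h1
    exact boxAvg_le_of_lintegral_rpow_le hp hF (by positivity) hFp hx h0 h1

/-- At the level `2 C Λ h^{-γ}`, the distribution function is at most of the order of `h^d`. -/
lemma exists_measure_lt_le (d k : ℕ) {p : ℝ} (hp : 1 < p) (hk : (k : ℝ) + 1 < d / p) :
    ∃ C : ℝ, 0 < C ∧ ∀ (Λ : ℝ) (D : (Fin d → ℕ) → (Fin d → ℝ) → ℝ)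
      (F : (Fin d → ℝ) → ℝ≥0∞), 0 < Λ → IsDominatedFamily (k + 1) (d / p) Λ D F →
      ∫⁻ z, F z ^ p ∂(unif d) ≤ ENNReal.ofReal Λ ^ p → ∀ h, 0 < h → h ≤ 1 / 2 →
      unif d {x | 2 * (C * Λ * h ^ ((k : ℝ) + 1 - d / p)) < |D 0 x|} ≤
        ENNReal.ofReal (2 ^ d * h ^ d) := by
  obtain ⟨C, hC, hmain⟩ := exists_ae_enorm_le d (d / p) k hk
  refine ⟨C, hC, fun Λ D F hΛ H hF h h0 h1 => ?_⟩
  have hp0 : 0 < p := by linarith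
  set γ : ℝ := (k : ℝ) + 1 - d / p with hγ
  have hpow : 0 < h ^ γ := Real.rpow_pos_of_pos h0 _
  set lev : ℝ := C * Λ * h ^ γ with hlev
  have hlev0 : 0 < lev := by positivity
  let W : (Fin d → ℝ) → ℝ≥0∞ := fun x => ∫⁻ t in Set.Ioc 0 h, boxAvg F x t
  have hW : Measurable W := by
    have hFm := H.measurable
    have m3 : Measurable fun q : ((Fin d → ℝ) × ℝ) × (Fin d → ℝ) =>
      F (q.1.1 + q.1.2 • (q.2 - q.1.1)) := by fun_prop
    have m2 : Measurable fun q : (Fin d → ℝ) × ℝ => boxAvg F q.1 q.2 :=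
      Measurable.lintegral_prod_right' m3
    exact Measurable.lintegral_prod_right' m2
  set b := ENNReal.ofReal (C * h ^ k) with hb
  have hsub : unif d {x | 2 * lev < |D 0 x|} ≤
      unif d {x | ENNReal.ofReal lev ^ p ≤ (b * W x) ^ p} := by
    refine measure_mono_ae ?_
    filter_upwards [hmain Λ D F H] with x hx hlt
    have h2 := hx h h0 (by linarith)
    have hlt' : 2 * lev < |D 0 x| := hlt
    change ENNReal.ofReal lev ^ p ≤ (b * W x) ^ p
    refine ENNReal.rpow_le_rpow ?_ hp0.le
    -- The first term of the pointwise bound equals `lev`, so a value above 2 `lev` forces the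
    -- integral term to be at least `lev`; Chebyshev applies to that term.
    have h3 : ENNReal.ofReal lev + ENNReal.ofReal lev ≤ ENNReal.ofReal lev + b * W x := by
      refine le_trans ?_ h2
      rw [← ENNReal.ofReal_add hlev0.le hlev0.le, Real.enorm_eq_ofReal_abs]
      exact ENNReal.ofReal_le_ofReal (by linarith)
    exact (ENNReal.add_le_add_iff_left ENNReal.ofReal_ne_top).1 h3
  refine hsub.trans ?_
  have hlev_ne : ENNReal.ofReal lev ^ p ≠ 0 :=
    (ENNReal.rpow_pos (ENNReal.ofReal_pos.2 hlev0) ENNReal.ofReal_ne_top).ne'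
  have hlev_top : ENNReal.ofReal lev ^ p ≠ ⊤ :=
    ENNReal.rpow_ne_top_of_nonneg hp0.le ENNReal.ofReal_ne_top
  refine (meas_ge_le_lintegral_div ((hW.const_mul b).pow_const p).aemeasurable hlev_ne
    hlev_top).trans ?_
  refine ENNReal.div_le_of_le_mul ?_
  simp_rw [ENNReal.mul_rpow_of_nonneg _ _ hp0.le]
  rw [lintegral_const_mul _ (hW.pow_const p)]
  refine (mul_le_mul_right ((lintegral_boxAvg_rpow_le hp H.measurable h0 h1).trans
    (mul_le_mul_right hF _)) _).trans_eq ?_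
  rw [ENNReal.ofReal_rpow_of_nonneg (by positivity) hp0.le,
    ENNReal.ofReal_rpow_of_nonneg (by positivity) hp0.le,
    ENNReal.ofReal_rpow_of_nonneg (by positivity) hp0.le, ← ENNReal.ofReal_mul (by positivity),
    ← ENNReal.ofReal_mul (by positivity), ← ENNReal.ofReal_mul (by positivity)]
  congr 1
  have e1 : (h ^ k) ^ p * h ^ p = (h ^ γ) ^ p * h ^ d := by
    rw [← Real.rpow_natCast h k, ← Real.rpow_natCast h d, ← Real.rpow_mul h0.le,
      ← Real.rpow_mul h0.le, ← Real.rpow_add h0, ← Real.rpow_add h0]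
    congr 1
    rw [hγ]
    field_simp
    ring
  rw [hlev, Real.mul_rpow (by positivity) (by positivity),
    Real.mul_rpow (by positivity) (by positivity), Real.mul_rpow (by positivity) (by positivity)]
  linear_combination C ^ p * 2 ^ d * Λ ^ p * e1

/-- The weak-type Sobolev inequality on the cube. -/
lemma exists_weak_type (d s : ℕ) {p L : ℝ} (hp : 1 < p) (hs : (s : ℝ) < d / p) (hL : 0 < L) :
    ∃ K : ℝ, 0 < K ∧ ∀ f ∈ sobolevBall d s p L, ∀ t : ℝ, 0 < t →
      unif d {x | t < |f x|} ≤ ENNReal.ofReal (K * t ^ (-(1 / p - s / d : ℝ)⁻¹)) := by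
  have hp0 : 0 < p := by linarith
  obtain ⟨Λ, hΛ, hfam⟩ := exists_isDominatedFamily d s hp hL
  have hcongr : ∀ {f g : (Fin d → ℝ) → ℝ}, f =ᵐ[unif d] g → ∀ t : ℝ,
      unif d {x | t < |f x|} = unif d {x | t < |g x|} := by
    intro f g hfg t
    refine measure_congr ?_
    filter_upwards [hfg] with x hx
    change (t < |f x|) = (t < |g x|)
    rw [hx]
  rcases s with _ | k
  -- Without derivatives the exponent is p and this is plain Chebyshev.
  · refine ⟨Λ ^ p, by positivity, fun f hf t ht => ?_⟩
    obtain ⟨D, F, hD, H, hF⟩ := hfam f hf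
    rw [hcongr hD]
    have ht' : ENNReal.ofReal t ^ p ≠ 0 :=
      (ENNReal.rpow_pos (ENNReal.ofReal_pos.2 ht) ENNReal.ofReal_ne_top).ne'
    calc unif d {x | t < |D 0 x|} ≤ unif d {x | ENNReal.ofReal t ^ p ≤ F x ^ p} := by
          refine measure_mono fun x hx => ?_
          refine ENNReal.rpow_le_rpow (le_trans ?_ (H.le 0 (by simp) x)) hp0.le
          rw [Real.enorm_eq_ofReal_abs]
          exact ENNReal.ofReal_le_ofReal (le_of_lt hx)
      _ ≤ (∫⁻ z, F z ^ p ∂(unif d)) / ENNReal.ofReal t ^ p :=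
          meas_ge_le_lintegral_div (H.measurable.pow_const p).aemeasurable ht'
            (ENNReal.rpow_ne_top_of_nonneg hp0.le ENNReal.ofReal_ne_top)
      _ ≤ ENNReal.ofReal Λ ^ p / ENNReal.ofReal t ^ p := by gcongr
      _ = _ := by
          rw [ENNReal.ofReal_rpow_of_pos hΛ, ENNReal.ofReal_rpow_of_pos ht,
            ← ENNReal.ofReal_div_of_pos (by positivity)]
          simp [Real.rpow_neg ht.le, div_eq_mul_inv]
  · push_cast at hs
    have hd : (0 : ℝ) < d := by
      by_contra hcon
      have : (d : ℝ) = 0 := le_antisymm (not_lt.1 hcon) (Nat.cast_nonneg d)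
      rw [this, zero_div] at hs
      linarith [(Nat.cast_nonneg k : (0 : ℝ) ≤ k)]
    obtain ⟨C, hC, hmain⟩ := exists_measure_lt_le d k hp hs
    set γ : ℝ := d / p - (k + 1) with hγ
    have hγ0 : 0 < γ := by linarith
    set r : ℝ := (1 / p - ((k + 1 : ℕ) : ℝ) / d)⁻¹ with hr
    have hrγ : r = d / γ := by
      rw [hr, hγ]
      push_cast
      have : 1 / p - ((k : ℝ) + 1) / d = (d / p - (k + 1)) / d := by field_simp
      rw [this, inv_div]
    set c : ℝ := 2 * (C * Λ) with hc
    have hc0 : 0 < c := by positivity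
    have hcr : 0 < c ^ r := by positivity
    refine ⟨2 ^ d * c ^ r, by positivity, fun f hf t ht => ?_⟩
    obtain ⟨D, F, hD, H, hF⟩ := hfam f hf
    rw [hcongr hD]
    -- The solution of 2CΛ h^{-γ} = t; then h^d is a constant times t^{-d/γ} = t^{-r}.
    set h : ℝ := (c / t) ^ (1 / γ) with hh
    have h0 : 0 < h := by positivity
    have hd' : h ^ d = c ^ r * t ^ (-r) := by
      rw [hh, ← Real.rpow_natCast, ← Real.rpow_mul (by positivity), Real.rpow_neg ht.le,
        ← div_eq_mul_inv, ← Real.div_rpow hc0.le ht.le, hrγ]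
      congr 1
      field_simp
    rw [mul_assoc, ← hd']
    rcases le_or_gt h (1 / 2) with h1 | h1
    · have := hmain Λ D F hΛ H hF h h0 h1
      have e : 2 * (C * Λ * h ^ ((k : ℝ) + 1 - d / p)) = t := by
        rw [hh, ← Real.rpow_mul (by positivity),
          show 1 / γ * ((k : ℝ) + 1 - d / p) = -1 by
            rw [show (k : ℝ) + 1 - d / p = -γ by rw [hγ]; ring]; field_simp,
          Real.rpow_neg_one, inv_div, ← mul_assoc, ← hc]
        field_simp
      rwa [e] at this
    -- At low levels the claimed bound (2h)^d exceeds 1 and says nothing.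
    · refine prob_le_one.trans ?_
      rw [← ENNReal.ofReal_one, ← mul_pow]
      exact ENNReal.ofReal_le_ofReal (one_le_pow₀ (by linarith))

/-! ### Moments of tails and truncations under a weak-type bound -/

section WeakType

variable {Ω : Type*} [MeasurableSpace Ω] {ν : Measure Ω} {g : Ω → ℝ} {K r : ℝ}

/-- Layer-cake formula: the tail part exceeds t only where |g| > max(t, M). Below M this gives a
constant times t^{m-1}, above M the power t^{m-r-1}, integrable at infinity because m < r. -/
lemma lintegral_tail_le (hg : AEMeasurable g ν) (hK : 0 < K)
    (h : ∀ t : ℝ, 0 < t → ν {x | t < |g x|} ≤ ENNReal.ofReal (K * t ^ (-r))) {m M : ℝ} (hm : 0 < m)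
    (hmr : m < r) (hM : 0 < M) :
    ∫⁻ x, ENNReal.ofReal ({x | M < |g x|}.indicator (fun x => |g x|) x ^ m) ∂ν ≤
      ENNReal.ofReal (K * (1 + m / (r - m)) * M ^ (m - r)) := by
  have hnn : ∀ x, 0 ≤ {x | M < |g x|}.indicator (fun x => |g x|) x := fun x =>
    Set.indicator_nonneg (fun _ _ => abs_nonneg _) x
  have hset : NullMeasurableSet {x | M < |g x|} ν :=
    nullMeasurableSet_lt aemeasurable_const hg.abs
  have hrm : 0 < r - m := by linarith
  rw [lintegral_rpow_eq_lintegral_meas_lt_mul ν (.of_forall hnn) (hg.abs.indicator₀ hset) hm]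
  have hbound : ∀ t, 0 < t → ν {a | t < {x | M < |g x|}.indicator (fun x => |g x|) a} ≤
      ENNReal.ofReal (K * (max t M) ^ (-r)) := fun t ht => by
    refine (measure_mono fun x hx => ?_).trans (h (max t M) (lt_max_of_lt_left ht))
    by_cases hx' : x ∈ {x | M < |g x|}
    · simp only [Set.mem_ofPred_eq, Set.indicator_of_mem hx'] at hx
      exact max_lt hx hx'
    · simp only [Set.mem_ofPred_eq, Set.indicator_of_notMem hx'] at hx
      exact absurd hx (not_lt.2 ht.le)
  have hsplit : Set.Ioi (0 : ℝ) = Set.Ioc 0 M ∪ Set.Ioi M := (Set.Ioc_union_Ioi_eq_Ioi hM.le).symm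
  have b1 : ∫⁻ t in Set.Ioc 0 M, ν {a | t < {x | M < |g x|}.indicator (fun x => |g x|) a} *
      ENNReal.ofReal (t ^ (m - 1)) ≤ ENNReal.ofReal (K * M ^ (-r) * (M ^ m / m)) := by
    calc _ ≤ ∫⁻ t in Set.Ioc 0 M, ENNReal.ofReal (K * M ^ (-r) * t ^ (m - 1)) := by
          refine setLIntegral_mono' measurableSet_Ioc fun t ht => ?_
          have := hbound t ht.1
          rw [max_eq_right ht.2] at this
          rw [ENNReal.ofReal_mul (by positivity)]
          gcongr
      _ = _ := by
          have hint : IntervalIntegrable (fun t : ℝ => K * M ^ (-r) * t ^ (m - 1)) volume 0 M :=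
            (intervalIntegral.intervalIntegrable_rpow' (by linarith)).const_mul _
          rw [← ofReal_integral_eq_lintegral_ofReal
            ((intervalIntegrable_iff_integrableOn_Ioc_of_le hM.le).1 hint),
            ← intervalIntegral.integral_of_le hM.le, intervalIntegral.integral_const_mul,
            integral_rpow (Or.inl (by linarith)), sub_add_cancel, Real.zero_rpow hm.ne', sub_zero]
          filter_upwards [ae_restrict_mem measurableSet_Ioc] with t ht
          have := ht.1
          positivity
  have b2 : ∫⁻ t in Set.Ioi M, ν {a | t < {x | M < |g x|}.indicator (fun x => |g x|) a} *
      ENNReal.ofReal (t ^ (m - 1)) ≤ ENNReal.ofReal (K * (M ^ (m - r) / (r - m))) := by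
    calc _ ≤ ∫⁻ t in Set.Ioi M, ENNReal.ofReal (K * t ^ (m - r - 1)) := by
          refine setLIntegral_mono' measurableSet_Ioi fun t ht => ?_
          have ht0 : 0 < t := hM.trans ht
          have := hbound t ht0
          rw [max_eq_left (le_of_lt ht)] at this
          refine (mul_le_mul_left this _).trans_eq ?_
          rw [← ENNReal.ofReal_mul (by positivity), mul_assoc, ← Real.rpow_add ht0]
          congr 3
          ring
      _ = _ := by
          have hint : IntegrableOn (fun t : ℝ => K * t ^ (m - r - 1)) (Set.Ioi M) :=
            (integrableOn_Ioi_rpow_of_lt (by linarith) hM).const_mul _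
          rw [← ofReal_integral_eq_lintegral_ofReal hint, integral_const_mul,
            integral_Ioi_rpow_of_lt (by linarith) hM, sub_add_cancel, ← neg_sub r m, neg_div_neg_eq]
          filter_upwards [ae_restrict_mem measurableSet_Ioi] with t ht
          have : 0 < t := hM.trans ht
          positivity
  rw [hsplit, lintegral_union measurableSet_Ioi Set.Ioc_disjoint_Ioi_same]
  refine (mul_le_mul_right (add_le_add b1 b2) _).trans_eq ?_
  rw [← ENNReal.ofReal_add (by positivity) (by positivity), ← ENNReal.ofReal_mul hm.le]
  congr 1
  have e : M ^ (m - r) = M ^ (-r) * M ^ m := by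
    rw [← Real.rpow_add hM]; congr 1; ring
  rw [e]
  field_simp

/-- Layer-cake formula again, now stopping at M; t^{m-r-1} is integrable at 0 because m > r. -/
lemma lintegral_truncation_le (hg : AEMeasurable g ν) (hK : 0 < K)
    (h : ∀ t : ℝ, 0 < t → ν {x | t < |g x|} ≤ ENNReal.ofReal (K * t ^ (-r))) {m M : ℝ} (hm : 0 < m)
    (hmr : r < m) (hM : 0 < M) :
    ∫⁻ x, ENNReal.ofReal (min |g x| M ^ m) ∂ν ≤
      ENNReal.ofReal (K * (m / (m - r)) * M ^ (m - r)) := by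
  have hrm : 0 < m - r := by linarith
  rw [lintegral_rpow_eq_lintegral_meas_lt_mul ν
    (.of_forall fun x => le_min (abs_nonneg _) hM.le) (hg.abs.min aemeasurable_const) hm]
  have hle : ∫⁻ t in Set.Ioi 0, ν {a | t < min |g a| M} * ENNReal.ofReal (t ^ (m - 1)) ≤
      ENNReal.ofReal (K * (M ^ (m - r) / (m - r))) := by
    calc _ ≤ ∫⁻ t in Set.Ioi (0 : ℝ), (Set.Ioc 0 M).indicator
            (fun t => ENNReal.ofReal (K * t ^ (m - r - 1))) t := by
          refine setLIntegral_mono' measurableSet_Ioi fun t ht => ?_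
          rw [Set.mem_Ioi] at ht
          by_cases htM : t ≤ M
          · rw [Set.indicator_of_mem (show t ∈ Set.Ioc 0 M from ⟨ht, htM⟩)]
            refine (mul_le_mul_left ((measure_mono fun x hx => ?_).trans (h t ht)) _).trans_eq ?_
            · have hx' : t < min |g x| M := hx
              exact (lt_min_iff.1 hx').1
            · rw [← ENNReal.ofReal_mul (by positivity), mul_assoc, ← Real.rpow_add ht]
              congr 3
              ring
          · have : {a | t < min |g a| M} = ∅ := by
              ext a
              simp only [Set.mem_ofPred_eq, lt_min_iff, Set.mem_empty_iff_false, iff_false]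
              exact fun h => htM h.2.le
            rw [this, measure_empty, zero_mul]
            exact zero_le
      _ = ∫⁻ t in Set.Ioc 0 M, ENNReal.ofReal (K * t ^ (m - r - 1)) := by
          rw [lintegral_indicator measurableSet_Ioc, Measure.restrict_restrict measurableSet_Ioc,
            Set.inter_eq_left.2 fun t ht => ht.1]
      _ = _ := by
          have hint : IntervalIntegrable (fun t : ℝ => K * t ^ (m - r - 1)) volume 0 M :=
            (intervalIntegral.intervalIntegrable_rpow' (by linarith)).const_mul _
          rw [← ofReal_integral_eq_lintegral_ofReal
            ((intervalIntegrable_iff_integrableOn_Ioc_of_le hM.le).1 hint),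
            ← intervalIntegral.integral_of_le hM.le, intervalIntegral.integral_const_mul,
            integral_rpow (Or.inl (by linarith)), sub_add_cancel, Real.zero_rpow hrm.ne', sub_zero]
          filter_upwards [ae_restrict_mem measurableSet_Ioc] with t ht
          have := ht.1
          positivity
  refine (mul_le_mul_right hle _).trans_eq ?_
  rw [← ENNReal.ofReal_mul hm.le]
  congr 1
  field_simp

end WeakType

/-! ### Risk of the truncated Monte Carlo estimator -/

lemma abs_clip_eq (y : ℝ) {M : ℝ} (hM : 0 < M) : |max (min y M) (-M)| = min |y| M := by
  rcases le_total 0 y with h | h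
  · rw [max_eq_left, abs_of_nonneg h, abs_of_nonneg (le_min h hM.le)]
    have := le_min h hM.le
    linarith
  · rw [min_eq_left (by linarith), abs_of_nonpos h, abs_of_nonpos (max_le h (by linarith)),
      ← min_neg_neg, neg_neg]

lemma abs_clip_pow_sub_le (q : ℕ) (y : ℝ) {M : ℝ} (hM : 0 < M) :
    |max (min y M) (-M) ^ q - y ^ q| ≤ if M < |y| then 2 * |y| ^ q else 0 := by
  split_ifs with h
  · refine (abs_sub _ _).trans ?_
    rw [abs_pow, abs_pow, abs_clip_eq y hM]
    have : min |y| M ^ q ≤ |y| ^ q := by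
      gcongr
      exact min_le_left _ _
    linarith
  · have := abs_le.1 (not_lt.1 h)
    rw [min_eq_left this.2, max_eq_left this.1, sub_self, abs_zero]

/-- Expected error of an empirical mean of a bounded function of independent points. -/
lemma lintegral_empirical_mean_sub_le {Ω : Type*} [MeasurableSpace Ω] (μ : Measure Ω)
    [IsProbabilityMeasure μ] {X : Ω → ℝ} (hX : MemLp X 2 μ) {n : ℕ} (hn : 1 ≤ n) {V : ℝ}
    (hV0 : 0 ≤ V) (hV : ∫⁻ x, ENNReal.ofReal (X x ^ 2) ∂μ ≤ ENNReal.ofReal V) :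
    ∫⁻ x : Fin n → Ω, ENNReal.ofReal |1 / (n : ℝ) * ∑ i, X (x i) - ∫ z, X z ∂μ|
      ∂(Measure.pi fun _ : Fin n => μ) ≤ ENNReal.ofReal (Real.sqrt (V / n)) := by
  set P := Measure.pi fun _ : Fin n => μ
  have hn0 : (0 : ℝ) < n := by exact_mod_cast hn
  have hXi : ∀ i : Fin n, MemLp (fun x : Fin n → Ω => X (x i)) 2 P := fun i =>
    hX.comp_measurePreserving (measurePreserving_eval (fun _ : Fin n => μ) i)
  have hEi : ∀ i : Fin n, ∫ x, X (x i) ∂P = ∫ z, X z ∂μ := fun i => by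
    have hmp := measurePreserving_eval (fun _ : Fin n => μ) i
    have h1 := integral_map (μ := P) hmp.measurable.aemeasurable (f := X)
      (by rw [hmp.map_eq]; exact hX.1)
    rw [hmp.map_eq] at h1
    exact h1.symm
  have hS : MemLp (∑ i, fun x : Fin n → Ω => X (x i)) 2 P := memLp_finsetSum' _ fun i _ => hXi i
  set Y : (Fin n → Ω) → ℝ := fun x => 1 / (n : ℝ) * (∑ i, fun x : Fin n → Ω => X (x i)) x with hY
  have hYm : MemLp Y 2 P := hS.const_mul _
  have hEY : ∫ x, Y x ∂P = ∫ z, X z ∂μ := by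
    simp only [hY, Finset.sum_apply]
    rw [integral_const_mul, integral_finsetSum _ fun i _ => (hXi i).integrable (by norm_num)]
    simp only [hEi, Finset.sum_const, Finset.card_univ, Fintype.card_fin, nsmul_eq_mul]
    field_simp
  have hvar : ProbabilityTheory.variance Y P ≤ V / n := by
    simp only [hY]
    rw [ProbabilityTheory.variance_const_mul, ProbabilityTheory.variance_sum_pi fun _ => hX]
    simp only [Finset.sum_const, Finset.card_univ, Fintype.card_fin, nsmul_eq_mul]
    have h1 : ProbabilityTheory.variance X μ ≤ V := by
      refine (ProbabilityTheory.variance_le_expectation_sq hX.1).trans ?_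
      simp only [Pi.pow_apply]
      rw [integral_eq_lintegral_of_nonneg_ae (.of_forall fun x => sq_nonneg (X x))
        (hX.1.pow 2)]
      exact ENNReal.toReal_le_of_le_ofReal hV0 hV
    calc (1 / (n : ℝ)) ^ 2 * (n * ProbabilityTheory.variance X μ)
        ≤ (1 / (n : ℝ)) ^ 2 * (n * V) := by gcongr
      _ = V / n := by field_simp
  have hY' : ∀ x : Fin n → Ω, ENNReal.ofReal |1 / (n : ℝ) * ∑ i, X (x i) - ∫ z, X z ∂μ| =
      ‖Y x - ∫ x, Y x ∂P‖ₑ := fun x => by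
    rw [hEY, Real.enorm_eq_ofReal_abs]
    simp [hY]
  simp_rw [hY']
  -- The mean absolute deviation is at most the standard deviation.
  have hJ := lintegral_rpow_le_mul_lintegral_rpow P (p := 2) (by norm_num)
    (G := fun x => ‖Y x - ∫ x, Y x ∂P‖ₑ) (hYm.1.sub aestronglyMeasurable_const).enorm
  rw [measure_univ, ENNReal.one_rpow, one_mul] at hJ
  have hev : ∫⁻ x, ‖Y x - ∫ x, Y x ∂P‖ₑ ^ (2 : ℝ) ∂P = ENNReal.ofReal
      (ProbabilityTheory.variance Y P) := by
    rw [hYm.ofReal_variance_eq, ProbabilityTheory.evariance]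
    simp
  rw [hev] at hJ
  rw [← ENNReal.rpow_le_rpow_iff (z := 2) (by norm_num)]
  refine hJ.trans ?_
  rw [ENNReal.ofReal_rpow_of_nonneg (Real.sqrt_nonneg _) (by norm_num)]
  refine ENNReal.ofReal_le_ofReal ?_
  rw [Real.rpow_two, Real.sq_sqrt (by positivity)]
  exact hvar

/-- Bias and standard deviation of the truncated Monte Carlo estimator under a weak-type bound. -/
lemma expectedError_truncatedMC_le {q n : ℕ} (hq : 1 ≤ q) (hn : 1 ≤ n) {f : (Fin d → ℝ) → ℝ}
    {p r K M : ℝ} (hqp : (q : ℝ) < p) (hf : MemLp f (ENNReal.ofReal p) (unif d))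
    (hK : 0 < K) (h : ∀ t : ℝ, 0 < t → unif d {x | t < |f x|} ≤ ENNReal.ofReal (K * t ^ (-r)))
    (hqr : (q : ℝ) < r) (hrq : r < 2 * q) (hM : 0 < M) :
    expectedError d n q (truncatedMC d n q M) f ≤
      ENNReal.ofReal (Real.sqrt (K * (2 * q / (2 * q - r)) * M ^ (2 * q - r : ℝ) / n) +
        2 * (K * (1 + q / (r - q)) * M ^ (q - r : ℝ))) := by
  have hq0 : (0 : ℝ) < q := by exact_mod_cast hq
  have hr1 : 0 < r - q := by linarith
  have hr2 : 0 < 2 * q - r := by linarith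
  have hfm : AEMeasurable f (unif d) := hf.1.aemeasurable
  let X : (Fin d → ℝ) → ℝ := fun z => max (min (f z) M) (-M) ^ q
  have hXm : AEMeasurable X (unif d) :=
    ((hfm.min aemeasurable_const).max aemeasurable_const).pow_const q
  have hXb : ∀ z, |X z| ≤ M ^ q := fun z => by
    rw [abs_pow, abs_clip_eq _ hM]
    gcongr
    exact min_le_right _ _
  have hX : MemLp X 2 (unif d) := MemLp.of_bound hXm.aestronglyMeasurable _ (.of_forall hXb)
  have hV : ∫⁻ z, ENNReal.ofReal (X z ^ 2) ∂(unif d) ≤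
      ENNReal.ofReal (K * (2 * q / (2 * q - r)) * M ^ (2 * q - r : ℝ)) := by
    refine le_trans (le_of_eq ?_)
      (lintegral_truncation_le hfm hK h (m := 2 * q) (by positivity) hrq hM)
    refine lintegral_congr fun z => ?_
    congr 1
    rw [← sq_abs, abs_pow, abs_clip_eq _ hM, ← pow_mul, mul_comm q 2,
      show (2 * q : ℝ) = ((2 * q : ℕ) : ℝ) by push_cast; ring, Real.rpow_natCast]
  have hstat := lintegral_empirical_mean_sub_le (unif d) hX hn (by positivity) hV
  have hfq : Integrable (fun z => f z ^ q) (unif d) := by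
    have h1 : MemLp f (q : ℝ≥0∞) (unif d) := hf.mono_exponent (by
      rw [← ENNReal.ofReal_natCast]; exact ENNReal.ofReal_le_ofReal hqp.le)
    refine (h1.integrable_norm_pow (by omega)).mono (hf.1.pow q) (.of_forall fun z => ?_)
    simp
  have hXi : Integrable X (unif d) := hX.integrable (by norm_num)
  have hbias : ENNReal.ofReal |(∫ z, X z ∂(unif d)) - moment d q f| ≤
      ENNReal.ofReal (2 * (K * (1 + q / (r - q)) * M ^ (q - r : ℝ))) := by
    rw [moment, ← integral_sub hXi hfq, ← Real.enorm_eq_ofReal_abs]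
    refine (enorm_integral_le_lintegral_enorm _).trans ?_
    rw [ENNReal.ofReal_mul zero_le_two]
    refine le_trans ?_ (mul_le_mul_right (lintegral_tail_le hfm hK h hq0 hqr hM) _)
    rw [← lintegral_const_mul' _ _ ENNReal.ofReal_ne_top]
    refine lintegral_mono fun z => ?_
    rw [Real.enorm_eq_ofReal_abs, ← ENNReal.ofReal_mul zero_le_two]
    refine ENNReal.ofReal_le_ofReal ((abs_clip_pow_sub_le q (f z) hM).trans (le_of_eq ?_))
    by_cases hz : M < |f z|
    · rw [if_pos hz, Set.indicator_of_mem (show z ∈ {x | M < |f x|} from hz), Real.rpow_natCast]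
    · rw [if_neg hz, Set.indicator_of_notMem (show z ∉ {x | M < |f x|} from hz),
        Real.zero_rpow hq0.ne', mul_zero]
  rw [ENNReal.ofReal_add (Real.sqrt_nonneg _) (by positivity)]
  refine le_trans ?_ (add_le_add hstat hbias)
  have hconst : ENNReal.ofReal |(∫ z, X z ∂(unif d)) - moment d q f| =
      ∫⁻ _ : Fin n → Fin d → ℝ, ENNReal.ofReal |(∫ z, X z ∂(unif d)) - moment d q f|
        ∂(Measure.pi fun _ : Fin n => unif d) := by
    rw [lintegral_const, measure_univ, mul_one]
  rw [hconst, ← lintegral_add_right _ measurable_const]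
  refine lintegral_mono fun x => ?_
  rw [← ENNReal.ofReal_add (abs_nonneg _) (abs_nonneg _)]
  refine ENNReal.ofReal_le_ofReal ?_
  exact abs_sub_le _ _ _

/-- The truncated Monte Carlo estimator with truncation level of the order `n^{1/p - s/d}` attains
the rate `n^{-q (s/d - 1/p) - 1}` on Sobolev balls. -/
theorem exists_expectedError_truncatedMC_le {d s q : ℕ} {p : ℝ} (hp : 1 < p) (hq : 1 ≤ q)
    (hqp : (q : ℝ) < p) (hs0 : 0 ≤ (s : ℝ) / d) (hs1 : (s : ℝ) / d < 1 / p - 1 / (2 * q))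
    (hsd : (s : ℝ) < d / p) {L a b : ℝ} (hL : 0 < L) (ha : 0 < a) (hb : 0 < b) :
    ∃ C : ℝ, 0 < C ∧ ∀ n : ℕ, 1 ≤ n → ∀ M : ℝ,
      a * (n : ℝ) ^ (1 / p - (s : ℝ) / d) ≤ M → M ≤ b * (n : ℝ) ^ (1 / p - (s : ℝ) / d) →
      ∀ f ∈ sobolevBall d s p L,
        expectedError d n q (truncatedMC d n q M) f ≤
          ENNReal.ofReal (C * (n : ℝ) ^ (-(q : ℝ) * ((s : ℝ) / d - 1 / p) - 1)) := by
  have hp0 : 0 < p := by linarith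
  have hq0 : (0 : ℝ) < q := by exact_mod_cast hq
  obtain ⟨K, hK, hweak⟩ := exists_weak_type d s hp hsd hL
  set ρ : ℝ := 1 / p - (s : ℝ) / d with hρ
  have hρ1 : 1 / (2 * q) < ρ := by linarith
  have hρ0 : 0 < ρ := lt_trans (by positivity) hρ1
  have hρ2 : ρ ≤ 1 / p := by linarith
  -- The Sobolev exponent. The smoothness restriction says exactly r < 2q (finite variance
  -- constant), and s ≥ 0 gives r ≥ p > q (finite bias constant).
  set r : ℝ := ρ⁻¹ with hr
  have hr0 : 0 < r := by positivity
  have hrp : p ≤ r := by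
    rw [hr, le_inv_comm₀ hp0 hρ0, ← one_div]; exact hρ2
  have hrq : r < 2 * q := by
    rw [hr, inv_lt_comm₀ hρ0 (by positivity), ← one_div]; exact hρ1
  have hqr : (q : ℝ) < r := hqp.trans_le hrp
  have hr1 : 0 < r - q := by linarith
  have hr2 : 0 < 2 * q - r := by linarith
  have hρr : ρ * r = 1 := mul_inv_cancel₀ hρ0.ne'
  set C1 : ℝ := Real.sqrt (K * (2 * q / (2 * q - r)) * b ^ (2 * q - r : ℝ)) with hC1
  set C2 : ℝ := 2 * (K * (1 + q / (r - q)) * a ^ (q - r : ℝ)) with hC2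
  have hC2p : 0 < C2 := by positivity
  have hC1p : 0 ≤ C1 := Real.sqrt_nonneg _
  refine ⟨C1 + C2, by positivity, fun n hn M haM hMb f hf => ?_⟩
  have hn0 : (0 : ℝ) < n := by exact_mod_cast hn
  have hnρ : 0 < (n : ℝ) ^ ρ := by positivity
  have hM : 0 < M := lt_of_lt_of_le (by positivity) haM
  refine (expectedError_truncatedMC_le hq hn hqp hf.1.1 hK (hweak f hf) hqr hrq hM).trans ?_
  refine ENNReal.ofReal_le_ofReal ?_
  rw [show -(q : ℝ) * ((s : ℝ) / d - 1 / p) - 1 = q * ρ - 1 by rw [hρ]; ring, add_mul]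
  refine add_le_add ?_ ?_
  -- As ρr = 1, the exponent ρ(2q - r) - 1 equals 2(qρ - 1). The variance uses the upper bound on M,
  -- the bias below uses the lower one.
  · have h1 : M ^ (2 * q - r : ℝ) / n ≤ b ^ (2 * q - r : ℝ) * ((n : ℝ) ^ (q * ρ - 1)) ^ 2 := by
      have h2 : M ^ (2 * q - r : ℝ) ≤ (b * (n : ℝ) ^ ρ) ^ (2 * q - r : ℝ) :=
        Real.rpow_le_rpow hM.le hMb hr2.le
      rw [Real.mul_rpow hb.le hnρ.le, ← Real.rpow_mul hn0.le] at h2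
      rw [div_le_iff₀ hn0]
      refine h2.trans_eq ?_
      rw [mul_assoc]
      congr 1
      rw [← Real.rpow_natCast, ← Real.rpow_mul hn0.le, ← Real.rpow_add_one hn0.ne']
      congr 1
      push_cast
      linear_combination -hρr
    calc Real.sqrt (K * (2 * q / (2 * q - r)) * M ^ (2 * q - r : ℝ) / n)
        ≤ Real.sqrt (K * (2 * q / (2 * q - r)) * b ^ (2 * q - r : ℝ) *
            ((n : ℝ) ^ (q * ρ - 1)) ^ 2) := by
          refine Real.sqrt_le_sqrt ?_
          rw [mul_div_assoc, mul_assoc _ (b ^ (2 * q - r : ℝ))]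
          gcongr
      _ = C1 * (n : ℝ) ^ (q * ρ - 1) := by
          rw [Real.sqrt_mul (by positivity), Real.sqrt_sq (by positivity)]
  · have h2 : M ^ (q - r : ℝ) ≤ (a * (n : ℝ) ^ ρ) ^ (q - r : ℝ) :=
      Real.rpow_le_rpow_of_nonpos (by positivity) haM (by linarith)
    rw [Real.mul_rpow ha.le hnρ.le, ← Real.rpow_mul hn0.le,
      show ρ * (q - r) = q * ρ - 1 by linear_combination -hρr] at h2
    calc 2 * (K * (1 + q / (r - q)) * M ^ (q - r : ℝ))
        ≤ 2 * (K * (1 + q / (r - q)) * (a ^ (q - r : ℝ) * (n : ℝ) ^ (q * ρ - 1))) := by gcongr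
      _ = C2 * (n : ℝ) ^ (q * ρ - 1) := by rw [hC2]; ring

/-! ### The minimax lower bound -/

lemma IsTestFunction.memLp {f : (Fin d → ℝ) → ℝ} (hf : IsTestFunction f) (p : ℝ≥0∞) :
    MemLp f p (unif d) := by
  obtain ⟨B, hB⟩ := hf.exists_bound
  exact MemLp.of_bound hf.1.continuous.aestronglyMeasurable B (.of_forall hB)

lemma zero_mem_sobolevBall (d s : ℕ) {p : ℝ} (hp : 0 < p) (L : ℝ) :
    (0 : (Fin d → ℝ) → ℝ) ∈ sobolevBall d s p L := by
  have hw : ∀ α : Fin d → ℕ, IsWeakDeriv α (0 : (Fin d → ℝ) → ℝ) 0 := fun α φ _ => by simp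
  have hd : ∀ α : Fin d → ℕ, derivNorm d p α 0 = 0 := fun α => by
    refine le_antisymm ?_ zero_le
    exact (iInf_le_of_le 0 (iInf₂_le_of_le MemLp.zero (hw α) (by simp)))
  refine ⟨⟨MemLp.zero, fun α _ => ⟨0, MemLp.zero, hw α⟩⟩, ?_⟩
  rw [sobolevNorm, Finset.sum_eq_zero fun α _ => by rw [hd, ENNReal.zero_rpow_of_pos hp],
    ENNReal.zero_rpow_of_pos (by positivity)]
  exact zero_le

/-- A test function belongs to the Sobolev ball if its classical derivatives are small. -/
lemma IsTestFunction.mem_sobolevBall {s : ℕ} {p L : ℝ} (hp : 0 < p) (hL : 0 ≤ L)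
    {f : (Fin d → ℝ) → ℝ} (hf : IsTestFunction f)
    (h : ∀ α ∈ multiIndices d s, eLpNorm (MomentEstimation.multiDeriv α f) (ENNReal.ofReal p)
      (unif d) ≤ ENNReal.ofReal (L / ((multiIndices d s).card : ℝ) ^ (1 / p))) :
    f ∈ sobolevBall d s p L := by
  have hcard : 0 < (multiIndices d s).card :=
    Finset.card_pos.2 ⟨0, mem_multiIndices.2 (by simp)⟩
  have hc : (0 : ℝ) < (multiIndices d s).card := by exact_mod_cast hcard
  refine ⟨⟨hf.memLp _, fun α _ => ⟨_, (hf.multiDeriv α).memLp _, isWeakDeriv_multiDeriv hf α⟩⟩, ?_⟩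
  have hd : ∀ α ∈ multiIndices d s, derivNorm d p α f ^ p ≤
      ENNReal.ofReal (L / ((multiIndices d s).card : ℝ) ^ (1 / p)) ^ p := fun α hα => by
    refine ENNReal.rpow_le_rpow (le_trans ?_ (h α hα)) hp.le
    exact iInf_le_of_le _
      (iInf₂_le_of_le ((hf.multiDeriv α).memLp _) (isWeakDeriv_multiDeriv hf α) le_rfl)
  rw [sobolevNorm, one_div, ENNReal.rpow_inv_le_iff hp]
  refine (Finset.sum_le_card_nsmul _ _ _ hd).trans_eq ?_
  rw [ENNReal.ofReal_rpow_of_nonneg (by positivity) hp.le,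
    ENNReal.ofReal_rpow_of_nonneg hL hp.le, ← ENNReal.ofReal_nsmul, nsmul_eq_mul,
    Real.div_rpow hL (by positivity), ← Real.rpow_mul hc.le, one_div_mul_cancel hp.ne',
    Real.rpow_one, mul_div_cancel₀ _ hc.ne']

lemma eLpNorm_le_of_forall_notMem_eq_zero {S : Set (Fin d → ℝ)} (hS : MeasurableSet S) {p c v : ℝ}
    (hp : 0 < p) (hc : 0 ≤ c) (hv : unif d S ≤ ENNReal.ofReal v) {g : (Fin d → ℝ) → ℝ}
    (h0 : ∀ x ∉ S, g x = 0) (hg : ∀ x, |g x| ≤ c) :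
    eLpNorm g (ENNReal.ofReal p) (unif d) ≤ ENNReal.ofReal c * ENNReal.ofReal v ^ (1 / p) := by
  have hp0 : ENNReal.ofReal p ≠ 0 := by simpa using hp
  refine (eLpNorm_mono (g := S.indicator fun _ => c) fun x => ?_).trans ?_
  · by_cases hx : x ∈ S
    · rw [Set.indicator_of_mem hx, Real.norm_of_nonneg hc]
      exact hg x
    · simp [h0 x hx]
  · rw [eLpNorm_indicator_const hS hp0 ENNReal.ofReal_ne_top, ENNReal.toReal_ofReal hp.le,
      Real.enorm_eq_ofReal hc]
    gcongr

/-- A function in the Sobolev ball that is concentrated on a set of measure at most `1 / (2 n)`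
and has a large moment. -/
lemma exists_concentrated_function (d s : ℕ) {q : ℕ} (hq : 1 ≤ q) (hd : 1 ≤ d) {p L : ℝ}
    (hp : 0 < p) (hL : 0 < L) :
    ∃ c : ℝ, 0 < c ∧ ∀ n : ℕ, 1 ≤ n → ∃ (f : (Fin d → ℝ) → ℝ) (S : Set (Fin d → ℝ)),
      f ∈ sobolevBall d s p L ∧ MeasurableSet S ∧ unif d S ≤ ENNReal.ofReal (1 / (2 * n)) ∧
      (∀ x ∉ S, f x = 0) ∧
      moment d q f = c * (n : ℝ) ^ ((q : ℝ) * (1 / p - (s : ℝ) / d) - 1) := by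
  obtain ⟨φ, hφ, hφ0, hφ1, hφs⟩ := exists_mollifier d
  have hdR : (0 : ℝ) < d := by exact_mod_cast hd
  choose B hB using fun α : Fin d → ℕ => (hφ.multiDeriv α).exists_bound
  have hB0 : ∀ α, 0 ≤ B α := fun α => (abs_nonneg _).trans (hB α 0)
  set A : ℝ := ∑ α ∈ multiIndices d s, B α + 1 with hA
  have hA0 : 0 < A := add_pos_of_nonneg_of_pos (Finset.sum_nonneg fun α _ => hB0 α) one_pos
  have hBA : ∀ α ∈ multiIndices d s, B α ≤ A := fun α hα =>
    (Finset.single_le_sum (fun α _ => hB0 α) hα).trans (by linarith)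
  have hcard : 0 < (multiIndices d s).card :=
    Finset.card_pos.2 ⟨0, mem_multiIndices.2 (by simp)⟩
  have hc : (0 : ℝ) < (multiIndices d s).card := by exact_mod_cast hcard
  set L' : ℝ := L / ((multiIndices d s).card : ℝ) ^ (1 / p) with hL'
  have hL'0 : 0 < L' := by positivity
  -- A bounds all derivatives of the bump up to order s, so this height brings each of their L^p
  -- norms down to L', the share of L allotted to one multi-index.
  set δ : ℝ := L' / A with hδ
  have hδ0 : 0 < δ := by positivity
  have hint : 0 < ∫ y, φ y ^ q := by
    have hne : ∃ y, φ y ≠ 0 := by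
      by_contra! hcon
      simp [hcon] at hφ1
    obtain ⟨y, hy⟩ := hne
    refine (hφ.1.continuous.pow q).integral_pos_of_hasCompactSupport_nonneg_nonzero ?_
      (fun y => pow_nonneg (hφ0 y) q) (x := y) (pow_ne_zero q hy)
    exact hφ.2.1.comp_left (g := fun t : ℝ => t ^ q) (zero_pow (by omega))
  refine ⟨δ ^ q * ∫ y, φ y ^ q, by positivity, fun n hn => ?_⟩
  have hn0 : (0 : ℝ) < n := by exact_mod_cast hn
  have hn1 : (1 : ℝ) ≤ n := by exact_mod_cast hn
  set ρ : ℝ := 1 / p - (s : ℝ) / d with hρ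
  -- Dilation by `lam` divides volumes by n and multiplies derivatives of order at most s by at most
  -- n^{s/d}; this cancels against the height n^ρ and the L^p norm of the support.
  set lam : ℝ := (n : ℝ) ^ (1 / d : ℝ) with hlam
  have hlam1 : 1 ≤ lam := Real.one_le_rpow hn1 (by positivity)
  have hlam0 : 0 < lam := by linarith
  have hlamd : lam ^ d = n := by
    rw [hlam, ← Real.rpow_natCast, ← Real.rpow_mul hn0.le, one_div_mul_cancel hdR.ne',
      Real.rpow_one]
  set b : Fin d → ℝ := center d - lam • center d with hb
  have hbx : ∀ x, b + lam • x - center d = lam • (x - center d) := fun x => by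
    rw [hb, smul_sub]; abel
  set S : Set (Fin d → ℝ) := Metric.closedBall (center d) (1 / (4 * lam)) with hS
  have hSm : MeasurableSet S := Metric.isClosed_closedBall.measurableSet
  have hzero : ∀ x ∉ S, b + lam • x ∉ tsupport φ := fun x hx hmem => by
    refine hx ?_
    have := hφs hmem
    rw [mem_closedBall_iff_norm, hbx, norm_smul, Real.norm_of_nonneg hlam0.le] at this
    rw [hS, mem_closedBall_iff_norm, le_div_iff₀ (by positivity)]
    linarith
  set f : (Fin d → ℝ) → ℝ := fun x => δ * (n : ℝ) ^ ρ * φ (b + lam • x) with hf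
  have hf0 : ∀ x ∉ S, f x = 0 := fun x hx => by
    simp only [hf]
    rw [image_eq_zero_of_notMem_tsupport (hzero x hx), mul_zero]
  have hfS : tsupport f ⊆ S := by
    refine closure_minimal (fun x hx => ?_) Metric.isClosed_closedBall
    by_contra hcon
    exact hx (hf0 x hcon)
  have hSQ : S ⊆ openCube d := by
    refine (Metric.closedBall_subset_closedBall ?_).trans closedBall_center_subset_openCube
    exact one_div_le_one_div_of_le (by norm_num) (by linarith)
  have hft : IsTestFunction f := by
    refine ⟨?_, ?_, hfS.trans hSQ⟩
    · exact contDiff_const.mul (hφ.1.comp (by fun_prop))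
    · exact IsCompact.of_isClosed_subset (isCompact_closedBall _ _) (isClosed_tsupport f) hfS
  have hvol : unif d S ≤ ENNReal.ofReal (1 / (2 * n)) := by
    refine (Measure.restrict_apply_le _ _).trans ?_
    rw [hS, Real.volume_pi_closedBall _ (by positivity), Fintype.card_fin]
    refine ENNReal.ofReal_le_ofReal ?_
    rw [show 2 * (1 / (4 * lam)) = (1 / 2) * lam⁻¹ by field_simp; norm_num, mul_pow, inv_pow, hlamd]
    -- The bump fills a box of side 1/2 before dilation, so d ≥ 1 gives the spare factor 1/2 in the
    -- measure of the support.
    have h2 : (1 / 2 : ℝ) ^ d ≤ 1 / 2 := by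
      calc (1 / 2 : ℝ) ^ d ≤ (1 / 2 : ℝ) ^ 1 :=
            pow_le_pow_of_le_one (by norm_num) (by norm_num) hd
        _ = 1 / 2 := pow_one _
    calc (1 / 2 : ℝ) ^ d * (n : ℝ)⁻¹ ≤ 1 / 2 * (n : ℝ)⁻¹ := by gcongr
      _ = 1 / (2 * n) := by field_simp
  refine ⟨f, S, ?_, hSm, hvol, hf0, ?_⟩
  · refine hft.mem_sobolevBall hp hL.le fun α hα => ?_
    have hαs := mem_multiIndices.1 hα
    have hD := multiDeriv_comp_affine α hφ.1 (δ * (n : ℝ) ^ ρ) lam b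
    rw [← hf] at hD
    refine (eLpNorm_le_of_forall_notMem_eq_zero hSm hp (c := δ * (n : ℝ) ^ (1 / p) * A)
      (by positivity) (hvol.trans (ENNReal.ofReal_le_ofReal
        (show 1 / (2 * (n : ℝ)) ≤ (n : ℝ)⁻¹ by
          rw [← one_div]; exact one_div_le_one_div_of_le hn0 (by linarith))))
      (fun x hx => ?_) (fun x => ?_)).trans ?_
    · rw [hD]
      simp only
      rw [image_eq_zero_of_notMem_tsupport fun h =>
        hzero x hx (tsupport_multiDeriv_subset α hφ.1 h), mul_zero]
    · rw [hD]
      simp only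
      rw [abs_mul, abs_of_nonneg (by positivity)]
      have h1 : lam ^ (∑ i, α i) ≤ (n : ℝ) ^ ((s : ℝ) / d) := by
        refine (pow_le_pow_right₀ hlam1 hαs).trans_eq ?_
        rw [hlam, ← Real.rpow_natCast, ← Real.rpow_mul hn0.le]
        congr 1
        field_simp
      have h2 : (n : ℝ) ^ ρ * (n : ℝ) ^ ((s : ℝ) / d) = (n : ℝ) ^ (1 / p) := by
        rw [← Real.rpow_add hn0]
        congr 1
        rw [hρ]
        ring
      rw [← h2, ← mul_assoc]
      gcongr
      exact (hB α _).trans (hBA α hα)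
    · rw [ENNReal.ofReal_rpow_of_pos (by positivity), ← ENNReal.ofReal_mul (by positivity)]
      refine ENNReal.ofReal_le_ofReal (le_of_eq ?_)
      have hnp : (n : ℝ) ^ (1 / p) ≠ 0 := by positivity
      rw [Real.inv_rpow hn0.le, mul_right_comm δ, mul_assoc (δ * A), mul_inv_cancel₀ hnp, mul_one,
        hδ, div_mul_cancel₀ _ hA0.ne']
  · have h1 : moment d q f = ∫ x, f x ^ q :=
      integral_unif_eq_integral fun x hx => by
        rw [hft.eq_zero hx, zero_pow (by omega)]
    rw [h1]
    simp only [hf, mul_pow]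
    rw [integral_const_mul, Measure.integral_comp_smul volume (fun y => φ (b + y) ^ q),
      integral_add_left_eq_self (fun y => φ y ^ q) b, Module.finrank_fin_fun, hlamd,
      abs_of_pos (by positivity), smul_eq_mul, Real.rpow_sub_one hn0.ne', mul_comm (q : ℝ) ρ,
      Real.rpow_mul hn0.le, Real.rpow_natCast]
    ring

/-- Bernoulli's inequality: (1 - 1/(2n))^n ≥ 1/2. -/
lemma half_le_measure_pi_compl {S : Set (Fin d → ℝ)} (hS : MeasurableSet S) {n : ℕ} (hn : 1 ≤ n)
    (hv : unif d S ≤ ENNReal.ofReal (1 / (2 * n))) :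
    ENNReal.ofReal (1 / 2) ≤
      (Measure.pi fun _ : Fin n => unif d) (Set.univ.pi fun _ => Sᶜ) := by
  have hn0 : (0 : ℝ) < n := by exact_mod_cast hn
  have hn1 : (1 : ℝ) ≤ n := by exact_mod_cast hn
  have hsmall : 1 / (2 * (n : ℝ)) ≤ 1 := by
    rw [div_le_one (by positivity)]; linarith
  have h1 : ENNReal.ofReal (1 - 1 / (2 * n)) ≤ unif d Sᶜ := by
    rw [prob_compl_eq_one_sub hS, ENNReal.ofReal_sub _ (by positivity), ENNReal.ofReal_one]
    exact tsub_le_tsub_left hv 1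
  rw [Measure.pi_pi, Finset.prod_const, Finset.card_univ, Fintype.card_fin]
  refine le_trans ?_ (pow_le_pow_left' h1 n)
  rw [← ENNReal.ofReal_pow (by linarith)]
  refine ENNReal.ofReal_le_ofReal ?_
  have h2 := one_add_mul_le_pow (a := -(1 / (2 * (n : ℝ)))) (by linarith) n
  have e : 1 + (n : ℝ) * -(1 / (2 * n)) = 1 / 2 := by field_simp; norm_num
  rw [e] at h2
  simpa [sub_eq_add_neg] using h2

/-- Two functions that agree outside of a small set cannot be told apart by an estimator. -/
lemma moment_le_expectedError_add {q n : ℕ} (hq : 1 ≤ q) (hn : 1 ≤ n) {H : Estimator d n}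
    (hH : Measurable fun z : (Fin n → Fin d → ℝ) × (Fin n → ℝ) => H z.1 z.2)
    {f : (Fin d → ℝ) → ℝ} {S : Set (Fin d → ℝ)} (hS : MeasurableSet S)
    (hv : unif d S ≤ ENNReal.ofReal (1 / (2 * n))) (hf : ∀ x ∉ S, f x = 0) :
    ENNReal.ofReal (moment d q f) * ENNReal.ofReal (1 / 2) ≤
      expectedError d n q H 0 + expectedError d n q H f := by
  have h0 : moment d q (0 : (Fin d → ℝ) → ℝ) = 0 := by
    simp [moment, zero_pow (show q ≠ 0 by omega)]
  set E : Set (Fin n → Fin d → ℝ) := Set.univ.pi fun _ => Sᶜ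
  have hE : MeasurableSet E := MeasurableSet.univ_pi fun _ => hS.compl
  -- Splitting the integral of a sum needs only one measurable summand, and f itself is not assumed
  -- measurable.
  have hm : Measurable fun x : Fin n → Fin d → ℝ =>
      ENNReal.ofReal |H x (fun i => (0 : (Fin d → ℝ) → ℝ) (x i)) - moment d q 0| := by
    have : Measurable fun x : Fin n → Fin d → ℝ => H x (fun _ => 0) :=
      hH.comp (measurable_id.prodMk measurable_const)
    exact (ENNReal.measurable_ofReal.comp (measurable_norm.comp (this.sub_const _)))
  rw [expectedError, expectedError, ← lintegral_add_left hm]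
  calc ENNReal.ofReal (moment d q f) * ENNReal.ofReal (1 / 2)
      ≤ ENNReal.ofReal (moment d q f) * (Measure.pi fun _ : Fin n => unif d) E :=
        mul_le_mul_right (half_le_measure_pi_compl hS hn hv) _
    _ = ∫⁻ _ in E, ENNReal.ofReal (moment d q f) ∂(Measure.pi fun _ : Fin n => unif d) :=
        (setLIntegral_const _ _).symm
    _ ≤ ∫⁻ x in E, (ENNReal.ofReal |H x (fun i => (0 : (Fin d → ℝ) → ℝ) (x i)) - moment d q 0| +
          ENNReal.ofReal |H x (fun i => f (x i)) - moment d q f|)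
          ∂(Measure.pi fun _ : Fin n => unif d) := by
        refine setLIntegral_mono' hE fun x hx => ?_
        have e : (fun i => f (x i)) = fun i => (0 : (Fin d → ℝ) → ℝ) (x i) := by
          ext i
          exact hf _ (hx i (Set.mem_univ i))
        rw [e, h0, ← ENNReal.ofReal_add (abs_nonneg _) (abs_nonneg _)]
        refine ENNReal.ofReal_le_ofReal ?_
        generalize H x (fun i => (0 : (Fin d → ℝ) → ℝ) (x i)) = y
        have h3 := le_abs_self (y - 0)
        have h4 := neg_abs_le (y - moment d q f)
        linarith
    _ ≤ _ := setLIntegral_le_lintegral _ _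

/-- Two-point method with 0 and the concentrated bump, both in the ball: half the moment of the bump
is at most the sum of the two risks, hence at most twice the supremum. This explains c/4. -/
theorem exists_le_minimaxRisk {d s q : ℕ} {p : ℝ} (hp : 0 < p) (hq : 1 ≤ q) (hd : 1 ≤ d) {L : ℝ}
    (hL : 0 < L) :
    ∃ c : ℝ, 0 < c ∧ ∀ n : ℕ, 1 ≤ n →
      ENNReal.ofReal (c * (n : ℝ) ^ (-(q : ℝ) * ((s : ℝ) / d - 1 / p) - 1)) ≤
        minimaxRisk d n q s p L := by
  obtain ⟨c, hc, hmain⟩ := exists_concentrated_function d s hq hd hp hL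
  refine ⟨c / 4, by positivity, fun n hn => ?_⟩
  obtain ⟨f, S, hfB, hS, hv, hf0, hmom⟩ := hmain n hn
  refine le_iInf₂ fun H hH => ?_
  have h1 := moment_le_expectedError_add hq hn hH hS hv hf0
  set sup := ⨆ f ∈ sobolevBall d s p L, expectedError d n q H f with hsup
  have h2 : expectedError d n q H 0 ≤ sup :=
    le_iSup₂ (f := fun f (_ : f ∈ sobolevBall d s p L) => expectedError d n q H f) 0
      (zero_mem_sobolevBall d s hp L)
  have h3 : expectedError d n q H f ≤ sup :=
    le_iSup₂ (f := fun f (_ : f ∈ sobolevBall d s p L) => expectedError d n q H f) f hfB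
  have h4 := h1.trans (add_le_add h2 h3)
  rw [← two_mul, hmom] at h4
  have hpos : 0 < (n : ℝ) ^ ((q : ℝ) * (1 / p - (s : ℝ) / d) - 1) := by
    have : (0 : ℝ) < n := by exact_mod_cast hn
    positivity
  have e : ENNReal.ofReal (c * (n : ℝ) ^ ((q : ℝ) * (1 / p - (s : ℝ) / d) - 1)) *
      ENNReal.ofReal (1 / 2) =
      2 * ENNReal.ofReal (c / 4 * (n : ℝ) ^ (-(q : ℝ) * ((s : ℝ) / d - 1 / p) - 1)) := by
    rw [show -(q : ℝ) * ((s : ℝ) / d - 1 / p) - 1 = (q : ℝ) * (1 / p - (s : ℝ) / d) - 1 by ring,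
      ← ENNReal.ofReal_mul (by positivity), ← ENNReal.ofReal_ofNat 2,
      ← ENNReal.ofReal_mul (by norm_num)]
    congr 1
    ring
  rw [e] at h4
  exact (ENNReal.mul_le_mul_iff_right two_ne_zero ENNReal.ofNat_ne_top).1 h4

end MomentEstimation

end

theorem theorem3p2 (d s q : ℕ) (p : ℝ) (hp : 2 < p) (hqp : (q : ℝ) < p) (hpq : p < 2 * q)
    (hs : (s : ℝ) < (d : ℝ) * (2 * q - p) / (2 * p * q)) :
    (∀ L a b : ℝ, 0 < L → 0 < a → 0 < b →
      ∃ C : ℝ, 0 < C ∧ ∀ n : ℕ, 1 ≤ n → ∀ M : ℝ,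
        a * (n : ℝ) ^ (1 / p - (s : ℝ) / d) ≤ M → M ≤ b * (n : ℝ) ^ (1 / p - (s : ℝ) / d) →
        ∀ f ∈ MomentEstimation.sobolevBall d s p L,
          MomentEstimation.expectedError d n q (MomentEstimation.truncatedMC d n q M) f ≤
            ENNReal.ofReal (C * (n : ℝ) ^ (-(q : ℝ) * ((s : ℝ) / d - 1 / p) - 1))) ∧
    (∀ L : ℝ, 0 < L →
      ∃ c : ℝ, 0 < c ∧ ∀ n : ℕ, 1 ≤ n →
        ENNReal.ofReal (c * (n : ℝ) ^ (-(q : ℝ) * ((s : ℝ) / d - 1 / p) - 1)) ≤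
          MomentEstimation.minimaxRisk d n q s p L) := by
  have hp0 : 0 < p := by linarith
  have hq0 : (0 : ℝ) < q := by linarith
  have hq : 1 ≤ q := by exact_mod_cast hq0
  have hs0 : (0 : ℝ) ≤ s := Nat.cast_nonneg s
  -- For d = 0 the smoothness hypothesis would read s < 0.
  have hd : 1 ≤ d := by
    rcases Nat.eq_zero_or_pos d with rfl | h
    · simp at hs
      linarith
    · exact h
  have hd0 : (0 : ℝ) < d := by exact_mod_cast hd
  have hs1 : (s : ℝ) / d < 1 / p - 1 / (2 * q) := by
    rw [div_lt_iff₀ hd0]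
    refine hs.trans_eq ?_
    field_simp
  have hsd : (s : ℝ) < d / p := by
    have : (0 : ℝ) < 1 / (2 * q) := by positivity
    have h2 : (s : ℝ) / d < 1 / p := by linarith
    rw [div_lt_iff₀ hd0] at h2
    rwa [one_div_mul_eq_div] at h2
  exact ⟨fun L a b hL ha hb => MomentEstimation.exists_expectedError_truncatedMC_le (by linarith)
      hq hqp (by positivity) hs1 hsd hL ha hb,
    fun L hL => MomentEstimation.exists_le_minimaxRisk hp0 hq hd hL⟩
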